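/- Let $n\ge 2$, $a_0,\dots,a_{n-1}\in\mathbb C$, $a_n=1$, and let $r_0,\dots,r_{n-1}\colon\mathbb R\to\mathbb C$ be (Bochner) almost periodic; put $r_n\equiv0$. Here $f\colon\mathbb R\to\mathbb C$ is almost periodic, $f\in\mathcal{AP}$, if it is continuous and every sequence $(b_k)$ of reals has a subsequence $(\tilde b_m)$ for which $f(\cdot+\tilde b_m)$ converges uniformly on $\mathbb R$. $\mathcal{AP}^{p}$ is the set of $z$ with $z,z',\dots,z^{(p)}\in\mathcal{AP}$. Write $P(c;x)=\sum_{i=0}^n c_ix^i$ and consider $$y^{(n)}+\sum_{i=0}^{n-1}\bigl(a_i+r_i(t)\bigr)y^{(i)}=0,\qquad t\in\mathbb R.\tag{1}$$ Assume that the roots $\lambda_1,\dots,\lambda_n$ of $P(a;x)$ have pairwise different real parts. **Notation.** The complete Bell polynomials are $B_0=1$, $B_{i+1}(x_1,\dots,x_{i+1})=\sum_{j=0}^i\binom ij B_{i-j}(x_1,\dots,x_{i-j})\,x_{j+1}$, and $f_i(x_1,\dots,x_i)=B_{i+1}(x_1,\dots,x_{i+1})-x_{i+1}$. For $\delta>0$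 let $m(\delta)=\max_{1\le i\le n-1}m_i(\delta)$, where $m_i(\delta)$ is the supremum of $|f_i(X)-f_i(Y)|/\|X-Y\|$ over $X\ne Y$ in the open ball of radius $\delta$ about $0$ in $\mathbb R^i$ with the norm $\|X\|=\sum_j|x_j|$. For $\omega\in\mathbb C$ with $\Re\omega\neq0$ let $g_\omega(t,s)=-\operatorname{sgn}(\Re\omega)e^{\omega(t-s)}$ if $\operatorname{sgn}(\Re\omega)(t-s)<0$ and $g_\omega(t,s)=0$ otherwise, and put $G_\omega[f](t)=\int_{\mathbb R}g_\omega(t,s)f(s)\,ds$, $I_\omega[f](t)=\int_{\mathbb R}|g_\omega(t,s)f(s)|\,ds$. Let $\|\cdot\|_\infty$ be the supremum norm on $\mathbb R$. For each $k$ and all $j\neq k$ let $$\gamma_{kj}=\lambda_j-\lambda_k,\quad \alpha_{kj}=\Re\gamma_{kj},\quad \Gamma_{kj}=\prod_{l\ne k,j}(\gamma_{kj}-\gamma_{kl}),\quad \tilde\alpha_{kj}=\sum_{i=0}^{n-2}|\gamma_{kj}|^i,\quad G^{\lambda_k}[f]=\sum_{j\ne k}\frac1{\Gamma_{kj}}G_{\gamma_{kj}}[f],$$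 $$L_0^{\lambda_k}=\sum_{j\neq k}\sum_{l=1}^{n-1}\frac{\tilde\alpha_{kj}}{|\Gamma_{kj}|\,l!}\Bigl\|I_{\alpha_{kj}}\bigl[\partial_x^lP(r;\lambda_k)\bigr]\Bigr\|_\infty,\qquad H_{\lambda_k}=\Bigl\|\sum_{i=0}^{n-2}\bigl|G^{\lambda_k}[P(r;\lambda_k)]^{(i)}\bigr|\Bigr\|_\infty,$$ $$Q_0^{\lambda_k}=\sum_{j\ne k}\sum_{i=2}^n\sum_{l=0}^{i-2}\frac{\tilde\alpha_{kj}}{|\Gamma_{kj}|}\binom il|\lambda_k|^l\Bigl(\frac{|a_i|}{|\alpha_{kj}|}+\bigl\|I_{\alpha_{kj}}[|r_i|]\bigr\|_\infty\Bigr).$$ If $L_0^{\lambda_k}<1$, let $\delta_{\lambda_k}>0$ be the number with $0<m(\delta)<(1-L_0^{\lambda_k})/Q_0^{\lambda_k}$ for $0<\delta<\delta_{\lambda_k}$ and $m(\delta_{\lambda_k})=(1-L_0^{\lambda_k})/Q_0^{\lambda_k}$. For a function $z$ put $$\mathcal D_kz=\sum_{j=1}^n\frac1{j!}\partial_x^jP(a;\lambda_k)z^{(j-1)},\qquad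 \mathcal L_k(t,z)=\sum_{j=1}^{n-1}\frac1{j!}\partial_x^jP(r(t);\lambda_k)z^{(j-1)}(t),$$ $$\mathcal F_k(t,Z)=\sum_{i=2}^n\sum_{j=0}^{n-i}\binom{i+j}j\bigl(a_{i+j}+r_{i+j}(t)\bigr)\lambda_k^j\,f_{i-1}\bigl(z(t),\dots,z^{(i-2)}(t)\bigr),$$ $$\Phi_k[z](t)=P(r(t);\lambda_k)+\mathcal L_k(t,z)+\mathcal F_k(t,Z),$$ with $\lambda_k^0=1$ also for $\lambda_k=0$. Let $V=(\lambda_k^{i-1})_{i,k=1}^n$ be the Vandermonde matrix and $\|B\|_1=\max_k\sum_i|b_{ik}|$. **Theorem.** Assume that for every $k$ we have $L_0^{\lambda_k}<1$ and that there are constants $M_k\in(0,\min_j\delta_{\lambda_j})$ with $$H_{\lambda_k}\le\bigl[1-L_0^{\lambda_k}-m(M_k)Q_0^{\lambda_k}\bigr]M_k\quad(k=1,\dots,n)$$ and $$\max_k\Bigl(M_k\bigl(m(M_k)+1\bigr)\sum_{i=2}^n\bigl[(|\lambda_k|+1)^{i-1}-|\lambda_k|^{i-1}\bigr]\Bigr)\,\|V^{-1}\|_1<1.$$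 Then there are a fundamental system $y_1,\dots,y_n$ of (1), i.e. $n$ solutions on $\mathbb R$ that are linearly independent over $\mathbb C$, and functions $z_1,\dots,z_n\in\mathcal{AP}^{n-2}$ such that, for every $k$ and $t\in\mathbb R$, $$y_k(t)=e^{\lambda_kt}\exp\Bigl(-\sum_{j\ne k}\frac1{\Gamma_{kj}\gamma_{kj}}G_{\gamma_{kj}}\bigl[\Phi_k[z_k]\bigr](t)\Bigr)\exp\Bigl((-1)^n\prod_{j\ne k}(\lambda_j-\lambda_k)^{-1}\int_0^t\Phi_k[z_k](s)\,ds\Bigr),$$ and $z_k$ satisfies the differential equation $\mathcal D_kz_k+\Phi_k[z_k]=0$ and the integral equation $z_k=-G^{\lambda_k}\bigl[\Phi_k[z_k]\bigr]$ on $\mathbb R$. -/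

import Mathlib

noncomputable section

namespace PoincarePerron

open Filter Polynomial

/-! ### Almost periodic functions -/

/-- Bochner almost periodicity: `r` is continuous and every sequence of translates of `r` has a
subsequence that converges uniformly on the real line. -/
def AlmostPeriodic (r : ℝ → ℂ) : Prop :=
  Continuous r ∧ ∀ b : ℕ → ℝ, ∃ φ : ℕ → ℕ, StrictMono φ ∧ ∃ g : ℝ → ℂ,
    TendstoUniformly (fun (m : ℕ) (t : ℝ) => r (t + b (φ m))) g atTop

/-- The space of functions which are `p` times continuously differentiable, with
`z, z', …, z^(p)` almost periodic. -/
def AlmostPeriodicUpTo (p : ℕ) (z : ℝ → ℂ) : Prop :=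
  ContDiff ℝ (p : WithTop ℕ∞) z ∧ ∀ i ≤ p, AlmostPeriodic (iteratedDeriv i z)

/-- The supremum norm on the real line (used for bounded functions only). -/
def supNorm {E : Type*} [Norm E] (f : ℝ → E) : ℝ := ⨆ t : ℝ, ‖f t‖

/-! ### Green's kernels and operators -/

/-- The scalar Green kernel `g_ω(t,s)`. -/
def greenKernel (ω : ℂ) (t s : ℝ) : ℂ :=
  if Real.sign ω.re * (t - s) < 0 then
    -((Real.sign ω.re : ℝ) : ℂ) * Complex.exp (ω * ((t - s : ℝ) : ℂ))
  else 0

/-- `G_ω[f](t) = ∫ g_ω(t,s) f(s) ds`. -/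
def greenOp (ω : ℂ) (f : ℝ → ℂ) (t : ℝ) : ℂ := ∫ s : ℝ, greenKernel ω t s * f s

/-- `I_ω[f](t) = ∫ |g_ω(t,s) f(s)| ds`. -/
def absGreenOp (ω : ℂ) (f : ℝ → ℂ) (t : ℝ) : ℝ := ∫ s : ℝ, ‖greenKernel ω t s * f s‖

/-! ### Complete Bell polynomials and their nonlinear parts -/

/-- The complete Bell polynomial `B_i(x_1, …, x_i)`, evaluated at a sequence; the sequence is
indexed from `0`, so that `x j` stands for `x_{j+1}`. Only `x 0, …, x (i-1)` matter. -/
def completeBell {R : Type*} [CommRing R] : ℕ → (ℕ → R) → R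
  | 0, _ => 1
  | i + 1, x => ∑ j : Fin (i + 1), (Nat.choose i j : R) * completeBell (i - j) x * x j

/-- `f_i(x_1, …, x_i) = B_{i+1}(x_1, …, x_{i+1}) - x_{i+1}`. It does not depend on `x_{i+1}`. -/
def bellNonlinear {R : Type*} [CommRing R] (i : ℕ) (x : ℕ → R) : R :=
  completeBell (i + 1) x - x i

/-- Extension of a tuple by zero to a sequence. -/
def extendZero {R : Type*} [Zero R] {i : ℕ} (X : Fin i → R) (j : ℕ) : R :=
  if h : j < i then X ⟨j, h⟩ else 0

/-- `m_i(δ)`: the best Lipschitz constant of `f_i` on the ball of radius `δ` of `ℝ^i`, for the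
norm `‖X‖ = ∑ |x_j|`. -/
def lipBell (i : ℕ) (δ : ℝ) : ℝ :=
  sSup {q : ℝ | ∃ X Y : Fin i → ℝ, X ≠ Y ∧ ∑ j, |X j| < δ ∧ ∑ j, |Y j| < δ ∧
    q = |bellNonlinear i (extendZero X) - bellNonlinear i (extendZero Y)| / ∑ j, |X j - Y j|}

/-- `m(δ)`: the maximum of `m_i(δ)` over the `f_i` that occur for order `n`, i.e.
`i = 1, …, n-1`. -/
def lipMax (n : ℕ) (δ : ℝ) : ℝ := ⨆ i : Fin (n - 1), lipBell (i + 1) δ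

/-! ### The linear equation and the Riccati type equation -/

/-- `P(c; x) = ∑_{i=0}^n c_i x^i` as a polynomial. -/
def coeffPoly (n : ℕ) (c : ℕ → ℂ) : ℂ[X] := ∑ i ∈ Finset.range (n + 1), C (c i) * X ^ i

/-- The value at `x` of the `k`-th derivative `∂^k P(c; ·) / ∂x^k`. -/
def coeffPolyDeriv (n : ℕ) (c : ℕ → ℂ) (k : ℕ) (x : ℂ) : ℂ :=
  (derivative^[k] (coeffPoly n c)).eval x

/-- `y` is a (classical, global) solution of
`y^(n) + ∑_{i<n} (a_i + r_i(t)) y^(i) = 0`. -/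
def IsLinearSolution (n : ℕ) (a : ℕ → ℂ) (r : ℕ → ℝ → ℂ) (y : ℝ → ℂ) : Prop :=
  ContDiff ℝ (n : WithTop ℕ∞) y ∧
    ∀ t : ℝ, iteratedDeriv n y t
      + ∑ i ∈ Finset.range n, (a i + r i t) * iteratedDeriv i y t = 0

/-- A fundamental system of the `n`-th order linear equation: `n` linearly independent solutions. -/
def IsFundamentalSystem (n : ℕ) (a : ℕ → ℂ) (r : ℕ → ℝ → ℂ) (y : Fin n → ℝ → ℂ) : Prop :=
  (∀ k, IsLinearSolution n a r (y k)) ∧ LinearIndependent ℂ y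

/-- `P(r(t); x)`. -/
def pertTerm (n : ℕ) (r : ℕ → ℝ → ℂ) (x : ℂ) (t : ℝ) : ℂ :=
  (coeffPoly n (fun i => r i t)).eval x

/-- The constant coefficient linear operator
`(D z)(t) = ∑_{j=1}^n (1/j!) ∂^j P(a;x) z^(j-1)(t)`. -/
def linConst (n : ℕ) (a : ℕ → ℂ) (x : ℂ) (z : ℝ → ℂ) (t : ℝ) : ℂ :=
  ∑ j ∈ Finset.Icc 1 n,
    (1 / (Nat.factorial j : ℂ)) * coeffPolyDeriv n a j x * iteratedDeriv (j - 1) z t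

/-- The variable coefficient linear part
`L(t,z) = ∑_{k=1}^{n-1} (1/k!) ∂^k P(r(t);x) z^(k-1)(t)`. -/
def linVar (n : ℕ) (r : ℕ → ℝ → ℂ) (x : ℂ) (z : ℝ → ℂ) (t : ℝ) : ℂ :=
  ∑ k ∈ Finset.Icc 1 (n - 1),
    (1 / (Nat.factorial k : ℂ)) * coeffPolyDeriv n (fun i => r i t) k x * iteratedDeriv (k - 1) z t

/-- The nonlinear part
`F(t,z,…) = ∑_{i=2}^n ∑_{j=0}^{n-i} (i+j choose j) (a_{i+j} + r_{i+j}(t)) x^j f_{i-1}(z,z',…)`. -/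
def nonlin (n : ℕ) (a : ℕ → ℂ) (r : ℕ → ℝ → ℂ) (x : ℂ) (z : ℝ → ℂ) (t : ℝ) : ℂ :=
  ∑ i ∈ Finset.Icc 2 n, ∑ j ∈ Finset.range (n - i + 1),
    (Nat.choose (i + j) j : ℂ) * (a (i + j) + r (i + j) t) * x ^ j *
      bellNonlinear (i - 1) (fun l => iteratedDeriv l z t)

/-- `P(r;x) + L(·,z) + F(·,Z)` as a function of time. -/
def riccatiRhs (n : ℕ) (a : ℕ → ℂ) (r : ℕ → ℝ → ℂ) (x : ℂ) (z : ℝ → ℂ) (t : ℝ) : ℂ :=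
  pertTerm n r x t + linVar n r x z t + nonlin n a r x z t

/-- `z` is a (classical, global) solution of the Riccati type equation
`D z + P(r;x) + L(t,z) + F(t,z,…,z^(n-2)) = 0`, of order `n - 1`. -/
def IsRiccatiSolution (n : ℕ) (a : ℕ → ℂ) (r : ℕ → ℝ → ℂ) (x : ℂ) (z : ℝ → ℂ) : Prop :=
  ContDiff ℝ ((n - 1 : ℕ) : WithTop ℕ∞) z ∧
    ∀ t : ℝ, linConst n a x z t + riccatiRhs n a r x z t = 0

/-! ### Constants attached to the root `λ_k`

The roots of the characteristic polynomial of `D` at `λ_k` are `γ_{kj} = λ_j - λ_k`, and are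
labelled here by the indices `j ≠ k` themselves. -/

variable {n : ℕ}

/-- `γ_{kj} = λ_j - λ_k`. -/
def gammaRoot (lam : Fin n → ℂ) (k j : Fin n) : ℂ := lam j - lam k

/-- `Γ_{kj} = ∏_{l ≠ k, j} (γ_{kj} - γ_{kl})`. -/
def gammaProd (lam : Fin n → ℂ) (k j : Fin n) : ℂ :=
  ∏ l ∈ (Finset.univ.erase k).erase j, (gammaRoot lam k j - gammaRoot lam k l)

/-- `α_{kj} = Re γ_{kj}`. -/
def alphaRe (lam : Fin n → ℂ) (k j : Fin n) : ℝ := (gammaRoot lam k j).re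

/-- `α̃_{kj} = ∑_{i=0}^{n-2} |γ_{kj}|^i`. -/
def alphaTilde (lam : Fin n → ℂ) (k j : Fin n) : ℝ :=
  ∑ i ∈ Finset.range (n - 1), ‖gammaRoot lam k j‖ ^ i

/-- The Green operator of `D` at `λ_k`: `G^{λ_k}[f] = ∑_{j ≠ k} Γ_{kj}⁻¹ G_{γ_{kj}}[f]`. -/
def greenRoot (lam : Fin n → ℂ) (k : Fin n) (f : ℝ → ℂ) (t : ℝ) : ℂ :=
  ∑ j ∈ Finset.univ.erase k, 1 / gammaProd lam k j * greenOp (gammaRoot lam k j) f t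

/-- `L_0^{λ_k}`. -/
def constL (r : ℕ → ℝ → ℂ) (lam : Fin n → ℂ) (k : Fin n) : ℝ :=
  ∑ j ∈ Finset.univ.erase k, ∑ l ∈ Finset.Icc 1 (n - 1),
    alphaTilde lam k j / (‖gammaProd lam k j‖ * (Nat.factorial l : ℝ)) *
      supNorm (absGreenOp (alphaRe lam k j : ℂ)
        (fun s => coeffPolyDeriv n (fun i => r i s) l (lam k)))

/-- `Q_0^{λ_k}`. -/
def constQ (a : ℕ → ℂ) (r : ℕ → ℝ → ℂ) (lam : Fin n → ℂ) (k : Fin n) : ℝ :=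
  ∑ j ∈ Finset.univ.erase k, ∑ i ∈ Finset.Icc 2 n, ∑ l ∈ Finset.range (i - 1),
    alphaTilde lam k j / ‖gammaProd lam k j‖ * (Nat.choose i l : ℝ) * ‖lam k‖ ^ l *
      (‖a i‖ / |alphaRe lam k j|
        + supNorm (absGreenOp (alphaRe lam k j : ℂ) (fun s => ((‖r i s‖ : ℝ) : ℂ))))

/-- `H_{λ_k} = ‖ ∑_{i=0}^{n-2} |G^{λ_k}[P(r;λ_k)]^(i)| ‖_∞`. -/
def constH (r : ℕ → ℝ → ℂ) (lam : Fin n → ℂ) (k : Fin n) : ℝ :=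
  supNorm (fun t : ℝ => ∑ i ∈ Finset.range (n - 1),
    ‖iteratedDeriv i (greenRoot lam k (pertTerm n r (lam k))) t‖)

/-- `d` is the number `δ_{λ_k} > 0` with `0 < m(δ) < (1 - L_0)/Q_0` on `(0, d)` and
`m(d) = (1 - L_0)/Q_0`. -/
def IsDelta (a : ℕ → ℂ) (r : ℕ → ℝ → ℂ) (lam : Fin n → ℂ) (k : Fin n) (d : ℝ) : Prop :=
  0 < d ∧
  (∀ δ : ℝ, 0 < δ → δ < d →
    0 < lipMax n δ ∧ lipMax n δ < (1 - constL r lam k) / constQ a r lam k) ∧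
  lipMax n d = (1 - constL r lam k) / constQ a r lam k

/-- The Vandermonde matrix whose row `i` consists of the `i`-th powers of the `λ_k`
(`i = 0, …, n-1`). -/
def vandermondeRows (lam : Fin n → ℂ) : Matrix (Fin n) (Fin n) ℂ :=
  (Matrix.vandermonde lam).transpose

/-- The matrix norm `‖B‖₁`, the maximal absolute column sum. -/
def colNorm (B : Matrix (Fin n) (Fin n) ℂ) : ℝ := ⨆ k, ∑ i, ‖B i k‖

/-- The explicit formula for the solution attached to `λ_k` and `z`. -/
def explicitSolution (a : ℕ → ℂ) (r : ℕ → ℝ → ℂ) (lam : Fin n → ℂ) (k : Fin n)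
    (z : ℝ → ℂ) (t : ℝ) : ℂ :=
  Complex.exp (lam k * (t : ℂ)) *
  Complex.exp (-∑ j ∈ Finset.univ.erase k,
    1 / (gammaProd lam k j * gammaRoot lam k j) *
      greenOp (gammaRoot lam k j) (riccatiRhs n a r (lam k) z) t) *
  Complex.exp ((-1) ^ n * (∏ j ∈ Finset.univ.erase k, (lam j - lam k)⁻¹) *
    ∫ s in (0 : ℝ)..t, riccatiRhs n a r (lam k) z s)

end PoincarePerron

end

open PoincarePerron

noncomputable section

namespace PoincarePerron

open MeasureTheory Set Filter

/-! ### The scalar Green kernel -/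

/-! Fix a root `λ_k` and look for a solution `y = exp(λ_k t + S)` with `S' = z`. Each quotient
`y^(i)/y` is then a polynomial in `z, z', …`, a binomial sum of complete Bell polynomials
(`bellShift`). Collecting Taylor coefficients of `P(a + r; ·)` at `λ_k`, and splitting each Bell
polynomial into its last variable and its nonlinear part `f_i`, turns equation (1) into `D_k z +
Φ_k[z] = 0` (`linConst_add_riccatiRhsSeq`).

The characteristic roots `γ_kj = λ_j - λ_k` of `D_k` lie off the imaginary axis, so `D_k` has a
right inverse `G^{λ_k}` on bounded continuous functions (`linConst_greenRoot`). It suffices to solve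
`z = -G^{λ_k}[Φ_k[z]]`. Differentiated up to order `n - 2`, this is a fixed point equation for the
jet `(z, …, z^(n-2))`. On the ball of radius `M_k` the map has contraction constant `L_0 + m(M_k)
Q_0 < 1`, and the condition on `H` makes the ball invariant (`exists_jet_fixedPoint`). The constant
`m` is defined by real tuples while the jets are complex; since the `f_i` have nonnegative
coefficients, passing to absolute values bridges the gap (`norm_bellNonlinear_sub_le_of_lt`).

A translate of the fixed point solves the problem with translated perturbation, so it moves at most
proportionally to the `r_i`; hence convergent translates of the `r_i` yield convergent translates of
the jet (`exists_norm_jetShift_le`, `almostPeriodic_of_jetShift`).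

The explicit formula has logarithmic derivative `λ_k - G^{λ_k}[Φ_k[z_k]] = λ_k + z_k`, hence solves
(1). At `t = 0` the Wronskian matrix with columns divided by `y_k(0)` is so close to the Vandermonde
matrix that it is still injective (`eq_zero_of_mulVec_eq_zero`), which gives independence. -/

lemma greenKernel_of_neg {ω : ℂ} (h : ω.re < 0) (t s : ℝ) :
    greenKernel ω t s = (Iio t).indicator (fun s : ℝ => Complex.exp (ω * ((t - s : ℝ) : ℂ))) s := by
  by_cases hs : s < t <;> simp [greenKernel, Real.sign_of_neg h, hs, indicator]

/-- Time reversal exchanges the two signs of `ω.re`, so integrability, the `L¹` norm and the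
derivative need proof only for `ω.re < 0`. -/
lemma greenKernel_neg (ω : ℂ) (t s : ℝ) :
    greenKernel ω t s = -greenKernel (-ω) (-t) (-s) := by
  have h1 : Real.sign (-ω).re * (-t - -s) = Real.sign ω.re * (t - s) := by
    rw [Complex.neg_re, Real.sign_neg]; ring
  have h2 : -ω * ((-t - -s : ℝ) : ℂ) = ω * ((t - s : ℝ) : ℂ) := by push_cast; ring
  unfold greenKernel
  rw [h1, h2]
  split_ifs <;> simp [Real.sign_neg]

lemma norm_greenKernel (ω : ℂ) (t s : ℝ) :
    ‖greenKernel ω t s‖ = ‖greenKernel (ω.re : ℂ) t s‖ := by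
  unfold greenKernel
  simp only [Complex.ofReal_re]
  split_ifs
  · rw [norm_mul, norm_mul, Complex.norm_exp, Complex.norm_exp]
    simp
  · rfl

lemma greenKernel_add (ω : ℂ) (t s c : ℝ) :
    greenKernel ω (t + c) (s + c) = greenKernel ω t s := by
  simp [greenKernel]

lemma integrable_greenKernel {ω : ℂ} (h : ω.re ≠ 0) (t : ℝ) :
    Integrable (greenKernel ω t) := by
  have key : ∀ {ω : ℂ} (_ : ω.re < 0) (t : ℝ), Integrable (greenKernel ω t) := by
    intro ω h t
    have : greenKernel ω t = (Iio t).indicator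
        (fun s : ℝ => Complex.exp (ω * ((t - s : ℝ) : ℂ))) :=
      funext (greenKernel_of_neg h t)
    rw [this, integrable_indicator_iff measurableSet_Iio]
    have h1 := ((integrableOn_exp_mul_complex_Iic (a := -ω) (by simpa using h) t).mono_set
      Iio_subset_Iic_self).const_mul (Complex.exp (ω * t))
    refine h1.congr (Eventually.of_forall fun s => ?_)
    simp only [← Complex.exp_add]
    congr 1; push_cast; ring
  rcases lt_or_gt_of_ne h with h | h
  · exact key h t
  · have := ((key (ω := -ω) (by simpa using h) (-t)).comp_neg).neg
    refine this.congr (Eventually.of_forall fun s => ?_)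
    simp [greenKernel_neg ω t s]

lemma integral_norm_greenKernel {ω : ℂ} (h : ω.re ≠ 0) (t : ℝ) :
    ∫ s, ‖greenKernel ω t s‖ = 1 / |ω.re| := by
  have key : ∀ {ω : ℂ} (_ : ω.re < 0) (t : ℝ), ∫ s, ‖greenKernel ω t s‖ = 1 / |ω.re| := by
    intro ω h t
    have h1 : ∀ s, ‖greenKernel ω t s‖ = (Iio t).indicator
        (fun s : ℝ => Real.exp (ω.re * t) * Real.exp (-ω.re * s)) s := by
      intro s
      rw [greenKernel_of_neg h, norm_indicator_eq_indicator_norm]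
      congr 1; ext s
      rw [Complex.norm_exp, ← Real.exp_add]
      congr 1; simp; ring
    simp_rw [h1]
    rw [integral_indicator measurableSet_Iio, ← integral_Iic_eq_integral_Iio,
      integral_const_mul, integral_exp_mul_Iic (by linarith), ← mul_div_assoc, ← Real.exp_add,
      abs_of_neg h]
    simp
  rcases lt_or_gt_of_ne h with h | h
  · exact key h t
  · have := key (ω := -ω) (by simpa using h) (-t)
    rw [← integral_neg_eq_self] at this
    simpa [greenKernel_neg ω t] using this

lemma integrable_greenKernel_mul {ω : ℂ} (h : ω.re ≠ 0) {f : ℝ → ℂ} (hf : Continuous f)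
    {B : ℝ} (hB : ∀ s, ‖f s‖ ≤ B) (t : ℝ) : Integrable (fun s => greenKernel ω t s * f s) :=
  (integrable_greenKernel h t).mul_bdd hf.aestronglyMeasurable (Eventually.of_forall hB)

lemma greenOp_neg_comp (ω : ℂ) (f : ℝ → ℂ) (t : ℝ) :
    greenOp ω f t = -greenOp (-ω) (fun s => f (-s)) (-t) := by
  unfold greenOp
  rw [← integral_neg_eq_self, ← integral_neg]
  congr 1; ext s
  rw [greenKernel_neg ω]; simp

lemma greenOp_shift (ω : ℂ) (f : ℝ → ℂ) (t c : ℝ) :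
    greenOp ω (fun s => f (s + c)) t = greenOp ω f (t + c) := by
  have := integral_add_right_eq_self (fun s => greenKernel ω (t + c) s * f s) c (μ := volume)
  unfold greenOp
  simpa only [greenKernel_add] using this

lemma greenOp_sub {ω : ℂ} (h : ω.re ≠ 0) {f g : ℝ → ℂ} (hf : Continuous f) (hg : Continuous g)
    {B B' : ℝ} (hB : ∀ s, ‖f s‖ ≤ B) (hB' : ∀ s, ‖g s‖ ≤ B') (t : ℝ) :
    greenOp ω (fun s => f s - g s) t = greenOp ω f t - greenOp ω g t := by
  unfold greenOp
  rw [← integral_sub (integrable_greenKernel_mul h hf hB t) (integrable_greenKernel_mul h hg hB' t)]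
  congr 1; ext s; ring

lemma norm_greenOp_le_integral {ω : ℂ} (h : ω.re ≠ 0) {f : ℝ → ℂ} {w : ℝ → ℝ} (hw : Continuous w)
    {B : ℝ} (hB : ∀ s, ‖w s‖ ≤ B) (hfw : ∀ s, ‖f s‖ ≤ w s) (t : ℝ) :
    ‖greenOp ω f t‖ ≤ ∫ s, ‖greenKernel (ω.re : ℂ) t s‖ * w s := by
  unfold greenOp
  refine norm_integral_le_of_norm_le ?_ (Eventually.of_forall fun s => ?_)
  · exact (integrable_greenKernel (ω := (ω.re : ℂ)) (by simpa using h) t).norm.mul_bdd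
      hw.aestronglyMeasurable (Eventually.of_forall hB)
  · rw [norm_mul, norm_greenKernel]
    exact mul_le_mul_of_nonneg_left (hfw s) (norm_nonneg _)

lemma norm_greenOp_le {ω : ℂ} (h : ω.re ≠ 0) {f : ℝ → ℂ} {B : ℝ} (hB : ∀ s, ‖f s‖ ≤ B) (t : ℝ) :
    ‖greenOp ω f t‖ ≤ 1 / |ω.re| * B := by
  have := norm_greenOp_le_integral h (w := fun _ => B) continuous_const
    (fun _ => le_rfl) hB t
  rwa [integral_mul_const, integral_norm_greenKernel (by simpa using h), Complex.ofReal_re] at this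

/-- Variation of constants: `greenOp ω f` is a bounded solution of `u' = ω u + f`. -/
lemma hasDerivAt_greenOp {ω : ℂ} (h : ω.re ≠ 0) {f : ℝ → ℂ} (hf : Continuous f)
    {B : ℝ} (hB : ∀ s, ‖f s‖ ≤ B) (t : ℝ) :
    HasDerivAt (greenOp ω f) (f t + ω * greenOp ω f t) t := by
  have key : ∀ {ω : ℂ} (_ : ω.re < 0) {f : ℝ → ℂ} (_ : Continuous f) (_ : ∀ s, ‖f s‖ ≤ B) (t : ℝ),
      HasDerivAt (greenOp ω f) (f t + ω * greenOp ω f t) t := by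
    intro ω h f hf hB t
    have hcont : Continuous fun s : ℝ => Complex.exp (-ω * s) * f s := by fun_prop
    have hint : ∀ u, IntegrableOn (fun s : ℝ => Complex.exp (-ω * s) * f s) (Iic u) := fun u =>
      (integrableOn_exp_mul_complex_Iic (a := -ω) (by simpa using h) u).mul_bdd
        hf.aestronglyMeasurable (Eventually.of_forall hB)
    -- Splitting the integral over `(-∞, u)` at `0` leaves an interval integral, to which the
    -- fundamental theorem of calculus applies.
    have h1 : greenOp ω f = fun u : ℝ => Complex.exp (ω * u) *
        ((∫ s in Iic (0 : ℝ), Complex.exp (-ω * s) * f s) +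
          ∫ s in (0 : ℝ)..u, Complex.exp (-ω * s) * f s) := by
      funext u
      rw [← intervalIntegral.integral_Iic_sub_Iic (hint 0) (hint u), add_sub_cancel,
        integral_Iic_eq_integral_Iio, ← integral_const_mul, ← integral_indicator measurableSet_Iio]
      unfold greenOp
      congr 1; ext s
      rw [greenKernel_of_neg h]
      by_cases hs : s ∈ Iio u
      · simp only [indicator_of_mem hs, ← mul_assoc, ← Complex.exp_add]
        congr 2; push_cast; ring
      · simp [indicator_of_notMem hs]
    have h2 := (hcont.integral_hasStrictDerivAt 0 t).hasDerivAt.const_add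
      (∫ s in Iic (0 : ℝ), Complex.exp (-ω * s) * f s)
    have h3 : HasDerivAt (fun u : ℝ => Complex.exp (ω * u)) (Complex.exp (ω * t) * ω) t := by
      have := ((hasDerivAt_id (t : ℂ)).const_mul ω).cexp.comp_ofReal
      simpa using this
    rw [h1]
    refine (h3.mul h2).congr_deriv ?_
    have : Complex.exp (ω * t) * (Complex.exp (-ω * t) * f t) = f t := by
      rw [← mul_assoc, ← Complex.exp_add]; simp
    rw [this, mul_comm (Complex.exp (ω * t)) ω, mul_assoc, add_comm]
  rcases lt_or_gt_of_ne h with h | h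
  · exact key h hf hB t
  · have h1 := (key (ω := -ω) (by simpa using h) (f := fun s => f (-s)) (by fun_prop)
      (fun s => hB _) (-t)).scomp t (hasDerivAt_neg t)
    have h2 := h1.neg
    have h3 : greenOp ω f = -fun x => greenOp (-ω) (fun s => f (-s)) (-x) :=
      funext (greenOp_neg_comp ω f)
    rw [h3]
    refine h2.congr_deriv ?_
    simp [add_comm]

end PoincarePerron
end

noncomputable section

namespace PoincarePerron

open Filter Topology

/-! ### Complete Bell polynomials: dependence, derivative, Lipschitz bounds -/

section Bell

lemma completeBell_congr {R : Type*} [CommRing R] {x y : ℕ → R} :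
    ∀ i : ℕ, (∀ j < i, x j = y j) → completeBell i x = completeBell i y
  | 0, _ => by simp [completeBell]
  | i + 1, h => by
    rw [completeBell, completeBell]
    refine Finset.sum_congr rfl fun j _ => ?_
    rw [completeBell_congr (i - j) fun l hl => h l (by omega), h j j.2]

/-- The last term of the Bell recursion is exactly the subtracted variable. What remains has natural
number coefficients and no subtraction, the form needed for majorants. -/
lemma bellNonlinear_eq_sum {R : Type*} [CommRing R] (i : ℕ) (x : ℕ → R) :
    bellNonlinear i x = ∑ j : Fin i, (Nat.choose i j : R) * completeBell (i - j) x * x j := by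
  rw [bellNonlinear, completeBell, Fin.sum_univ_castSucc]
  simp [completeBell]

lemma bellNonlinear_congr {R : Type*} [CommRing R] {x y : ℕ → R} (i : ℕ)
    (h : ∀ j < i, x j = y j) : bellNonlinear i x = bellNonlinear i y := by
  rw [bellNonlinear_eq_sum, bellNonlinear_eq_sum]
  refine Finset.sum_congr rfl fun j _ => ?_
  rw [completeBell_congr (i - j) fun l hl => h l (by omega), h j j.2]

lemma completeBell_succ_eq {R : Type*} [CommRing R] (i : ℕ) (x : ℕ → R) :
    completeBell (i + 1) x = x i + bellNonlinear i x := by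
  simp [bellNonlinear]

lemma bellNonlinear_zero_index {R : Type*} [CommRing R] (x : ℕ → R) : bellNonlinear 0 x = 0 := by
  simp [bellNonlinear_eq_sum]

lemma bellNonlinear_zero {R : Type*} [CommRing R] (i : ℕ) :
    bellNonlinear i (fun _ => (0 : R)) = 0 := by
  simp [bellNonlinear_eq_sum]

/-- The derivative of the complete Bell polynomial `B_i` at `x` in the direction `v`. -/
def completeBellDeriv {R : Type*} [CommRing R] : ℕ → (ℕ → R) → (ℕ → R) → R
  | 0, _, _ => 0
  | i + 1, x, v => ∑ j : Fin (i + 1), (Nat.choose i j : R) *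
      (completeBellDeriv (i - j) x v * x j + completeBell (i - j) x * v j)

/-- The derivative of `f_i` at `x` in the direction `v`. -/
def bellNonlinearDeriv {R : Type*} [CommRing R] (i : ℕ) (x v : ℕ → R) : R :=
  ∑ j : Fin i, (Nat.choose i j : R) *
      (completeBellDeriv (i - j) x v * x j + completeBell (i - j) x * v j)

lemma completeBellDeriv_smul {R : Type*} [CommRing R] (c : R) (x v : ℕ → R) :
    ∀ i : ℕ, completeBellDeriv i x (fun j => c * v j) = c * completeBellDeriv i x v
  | 0 => by simp [completeBellDeriv]
  | i + 1 => by
    rw [completeBellDeriv, completeBellDeriv, Finset.mul_sum]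
    refine Finset.sum_congr rfl fun j _ => ?_
    rw [completeBellDeriv_smul c x v (i - j)]
    ring

lemma bellNonlinearDeriv_smul {R : Type*} [CommRing R] (c : R) (x v : ℕ → R) (i : ℕ) :
    bellNonlinearDeriv i x (fun j => c * v j) = c * bellNonlinearDeriv i x v := by
  rw [bellNonlinearDeriv, bellNonlinearDeriv, Finset.mul_sum]
  refine Finset.sum_congr rfl fun j _ => ?_
  rw [completeBellDeriv_smul c x v (i - j)]
  ring

variable {𝕜 : Type*} [RCLike 𝕜]

lemma hasDerivAt_completeBell (x v : ℕ → 𝕜) (s : ℝ) :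
    ∀ i : ℕ, HasDerivAt (fun s : ℝ => completeBell i (fun j => x j + (s : 𝕜) * v j))
      (completeBellDeriv i (fun j => x j + (s : 𝕜) * v j) v) s
  | 0 => by simpa [completeBell, completeBellDeriv] using hasDerivAt_const s (1 : 𝕜)
  | i + 1 => by
    simp only [completeBell, completeBellDeriv]
    refine HasDerivAt.fun_sum fun j _ => ?_
    have h1 := hasDerivAt_completeBell x v s (i - j)
    have h2 : HasDerivAt (fun s : ℝ => x j + (s : 𝕜) * v j) (v j) s := by
      have := ((RCLike.ofRealCLM (K := 𝕜)).hasDerivAt (x := s)).mul_const (v j)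
      simpa using this.const_add (x j)
    refine ((h1.const_mul (Nat.choose i j : 𝕜)).mul h2).congr_deriv ?_
    ring

lemma hasDerivAt_bellNonlinear (x v : ℕ → 𝕜) (s : ℝ) (i : ℕ) :
    HasDerivAt (fun s : ℝ => bellNonlinear i (fun j => x j + (s : 𝕜) * v j))
      (bellNonlinearDeriv i (fun j => x j + (s : 𝕜) * v j) v) s := by
  simp only [bellNonlinear_eq_sum, bellNonlinearDeriv]
  refine HasDerivAt.fun_sum fun j _ => ?_
  have h1 := hasDerivAt_completeBell x v s (i - j)
  have h2 : HasDerivAt (fun s : ℝ => x j + (s : 𝕜) * v j) (v j) s := by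
    have := ((RCLike.ofRealCLM (K := 𝕜)).hasDerivAt (x := s)).mul_const (v j)
    simpa using this.const_add (x j)
  refine ((h1.const_mul (Nat.choose i j : 𝕜)).mul h2).congr_deriv ?_
  ring

/-- The coefficients are nonnegative, so the real polynomial at the absolute values is a majorant.
-/
lemma norm_completeBell_le {x : ℕ → 𝕜} {u : ℕ → ℝ} (h : ∀ j, ‖x j‖ ≤ u j) :
    ∀ i : ℕ, ‖completeBell i x‖ ≤ completeBell i u
  | 0 => by simp [completeBell]
  | i + 1 => by
    rw [completeBell, completeBell]
    refine norm_sum_le_of_le _ fun j _ => ?_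
    have h1 := norm_completeBell_le h (i - j)
    rw [norm_mul, norm_mul, RCLike.norm_natCast]
    have := (norm_nonneg _).trans h1
    gcongr
    exact h j

lemma norm_completeBellDeriv_le {x v : ℕ → 𝕜} {u w : ℕ → ℝ} (h : ∀ j, ‖x j‖ ≤ u j)
    (hv : ∀ j, ‖v j‖ ≤ w j) :
    ∀ i : ℕ, ‖completeBellDeriv i x v‖ ≤ completeBellDeriv i u w
  | 0 => by simp [completeBellDeriv]
  | i + 1 => by
    rw [completeBellDeriv, completeBellDeriv]
    refine norm_sum_le_of_le _ fun j _ => ?_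
    have h1 := norm_completeBell_le h (i - j)
    have h2 := norm_completeBellDeriv_le h hv (i - j)
    rw [norm_mul, RCLike.norm_natCast]
    have := (norm_nonneg _).trans h1
    have := (norm_nonneg _).trans h2
    gcongr
    refine norm_add_le_of_le ?_ ?_ <;> rw [norm_mul] <;> gcongr
    exacts [h j, hv j]

lemma norm_bellNonlinearDeriv_le {x v : ℕ → 𝕜} {u w : ℕ → ℝ} (h : ∀ j, ‖x j‖ ≤ u j)
    (hv : ∀ j, ‖v j‖ ≤ w j) (i : ℕ) :
    ‖bellNonlinearDeriv i x v‖ ≤ bellNonlinearDeriv i u w := by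
  rw [bellNonlinearDeriv, bellNonlinearDeriv]
  refine norm_sum_le_of_le _ fun j _ => ?_
  have h1 := norm_completeBell_le h (i - j)
  have h2 := norm_completeBellDeriv_le h hv (i - j)
  rw [norm_mul, RCLike.norm_natCast]
  have := (norm_nonneg _).trans h1
  have := (norm_nonneg _).trans h2
  gcongr
  refine norm_add_le_of_le ?_ ?_ <;> rw [norm_mul] <;> gcongr
  exacts [h j, hv j]

/-- Mean value inequality along the segment from `x` to `y`. -/
lemma norm_bellNonlinear_sub_le {x y : ℕ → 𝕜} (i : ℕ) {C : ℝ}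
    (h : ∀ s ∈ Set.Icc (0 : ℝ) 1,
      ‖bellNonlinearDeriv i (fun j => x j + (s : 𝕜) * (y j - x j)) (fun j => y j - x j)‖ ≤ C) :
    ‖bellNonlinear i y - bellNonlinear i x‖ ≤ C := by
  have := norm_image_sub_le_of_norm_deriv_le_segment_01'
    (fun s _ => (hasDerivAt_bellNonlinear x (fun j => y j - x j) s i).hasDerivWithinAt)
    (fun s hs => h s ⟨hs.1, hs.2.le⟩)
  simpa using this

lemma norm_segment_le (x y : 𝕜) {s : ℝ} (hs : s ∈ Set.Icc (0 : ℝ) 1) :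
    ‖x + (s : 𝕜) * (y - x)‖ ≤ (1 - s) * ‖x‖ + s * ‖y‖ := by
  have : x + (s : 𝕜) * (y - x) = ((1 - s : ℝ) : 𝕜) * x + (s : 𝕜) * y := by push_cast; ring
  rw [this]
  refine norm_add_le_of_le ?_ ?_
  · rw [norm_mul, RCLike.norm_ofReal, abs_of_nonneg (by linarith [hs.2])]
  · rw [norm_mul, RCLike.norm_ofReal, abs_of_nonneg hs.1]

/-- Needed for `lipBell` to be a genuine supremum: for an unbounded set `sSup` would take its
default value. -/
lemma bddAbove_lipBell (i : ℕ) (δ : ℝ) :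
    BddAbove {q : ℝ | ∃ X Y : Fin i → ℝ, X ≠ Y ∧ ∑ j, |X j| < δ ∧ ∑ j, |Y j| < δ ∧
      q = |bellNonlinear i (extendZero X) - bellNonlinear i (extendZero Y)| /
        ∑ j, |X j - Y j|} := by
  -- On a segment inside the ball every coordinate is at most `δ` in absolute value, and every
  -- coordinate of `X - Y` is at most `‖X - Y‖`; by majorisation the derivative at the constant
  -- point `δ` in direction `1` bounds all quotients.
  refine ⟨bellNonlinearDeriv i (fun _ => δ) (fun _ => 1), ?_⟩
  rintro q ⟨X, Y, hXY, hX, hY, rfl⟩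
  have hle : ∀ {X : Fin i → ℝ} (j : ℕ), |extendZero X j| ≤ ∑ j, |X j| := by
    intro X j
    unfold extendZero
    split_ifs with hj
    · exact Finset.single_le_sum (f := fun j => |X j|) (fun _ _ => abs_nonneg _)
        (Finset.mem_univ (⟨j, hj⟩ : Fin i))
    · simpa using Finset.sum_nonneg fun j (_ : j ∈ Finset.univ) => abs_nonneg (X j)
  obtain ⟨j₀, hj₀⟩ := Function.ne_iff.mp hXY
  have hpos : 0 < ∑ j, |X j - Y j| := Finset.sum_pos' (fun _ _ => abs_nonneg _)
    ⟨j₀, Finset.mem_univ _, abs_pos.mpr (sub_ne_zero.mpr hj₀)⟩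
  rw [div_le_iff₀ hpos, mul_comm, ← bellNonlinearDeriv_smul]
  refine norm_bellNonlinear_sub_le (𝕜 := ℝ) i fun s hs => ?_
  refine norm_bellNonlinearDeriv_le (fun j => ?_) (fun j => ?_) i
  · refine (norm_segment_le (𝕜 := ℝ) _ _ hs).trans ?_
    have h1 := (hle (X := Y) j).trans hY.le
    have h2 := (hle (X := X) j).trans hX.le
    simp only [Real.norm_eq_abs]
    nlinarith [hs.1, hs.2]
  · have : extendZero X j - extendZero Y j = extendZero (fun j => X j - Y j) j := by
      unfold extendZero; split_ifs <;> simp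
    rw [this, mul_one]
    exact hle j

lemma lipBell_nonneg (i : ℕ) (δ : ℝ) : 0 ≤ lipBell i δ := by
  refine Real.sSup_nonneg ?_
  rintro q ⟨X, Y, -, -, -, rfl⟩
  positivity

lemma abs_bellNonlinear_sub_le {i : ℕ} {δ : ℝ} {x y : ℕ → ℝ}
    (hx : ∑ j ∈ Finset.range i, |x j| < δ) (hy : ∑ j ∈ Finset.range i, |y j| < δ) :
    |bellNonlinear i x - bellNonlinear i y| ≤
      lipBell i δ * ∑ j ∈ Finset.range i, |x j - y j| := by
  have hext : ∀ x : ℕ → ℝ, bellNonlinear i (extendZero fun j : Fin i => x j) =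
      bellNonlinear i x := fun x =>
    bellNonlinear_congr i fun j hj => by simp [extendZero, hj]
  by_cases hxy : (fun j : Fin i => x j) = fun j : Fin i => y j
  · rw [← hext x, ← hext y, hxy, sub_self, abs_zero]
    exact mul_nonneg (lipBell_nonneg i δ) (Finset.sum_nonneg fun _ _ => abs_nonneg _)
  · obtain ⟨j₀, hj₀⟩ := Function.ne_iff.mp hxy
    have hpos : 0 < ∑ j ∈ Finset.range i, |x j - y j| :=
      Finset.sum_pos' (fun _ _ => abs_nonneg _)
        ⟨j₀, Finset.mem_range.mpr j₀.2, abs_pos.mpr (sub_ne_zero.mpr hj₀)⟩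
    rw [← div_le_iff₀ hpos]
    refine le_csSup (bddAbove_lipBell i δ) ⟨fun j => x j, fun j => y j, hxy, ?_, ?_, ?_⟩
    · rwa [Fin.sum_univ_eq_sum_range (fun j => |x j|)]
    · rwa [Fin.sum_univ_eq_sum_range (fun j => |y j|)]
    · rw [hext, hext, Fin.sum_univ_eq_sum_range (fun j => |x j - y j|)]

/-- A directional derivative at a point of the open ball is a limit of difference quotients taken
inside it, so the best Lipschitz constant bounds it. -/
lemma bellNonlinearDeriv_le {i : ℕ} {δ : ℝ} {x v : ℕ → ℝ}
    (hx : ∑ j ∈ Finset.range i, |x j| < δ) :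
    bellNonlinearDeriv i x v ≤ lipBell i δ * ∑ j ∈ Finset.range i, |v j| := by
  have h0 : 0 ≤ ∑ j ∈ Finset.range i, |v j| := Finset.sum_nonneg fun _ _ => abs_nonneg _
  have hd := hasDerivAt_bellNonlinear (𝕜 := ℝ) x v 0 i
  have hlim : Tendsto (fun s : ℝ => ∑ j ∈ Finset.range i, |x j + s * v j|) (𝓝 0)
      (𝓝 (∑ j ∈ Finset.range i, |x j|)) := by
    have : Continuous fun s : ℝ => ∑ j ∈ Finset.range i, |x j + s * v j| := by fun_prop
    simpa using this.tendsto 0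
  have := hd.le_of_lip' (C := lipBell i δ * ∑ j ∈ Finset.range i, |v j|)
    (mul_nonneg (lipBell_nonneg i δ) h0) (by
      filter_upwards [hlim.eventually_lt_const hx] with s hs
      refine (abs_bellNonlinear_sub_le (δ := δ) (by simpa using hs) (by simpa using hx)).trans ?_
      rw [mul_assoc]
      refine mul_le_mul_of_nonneg_left (le_of_eq ?_) (lipBell_nonneg i δ)
      simp [abs_mul, ← Finset.mul_sum, mul_comm])
  simp only [RCLike.ofReal_zero, zero_mul, add_zero, Real.norm_eq_abs] at this
  exact (le_abs_self _).trans this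

/-- The derivative along the complex segment is majorised by the real derivative at the absolute
values, and the real vector of absolute values stays in the ball. Thus the real constant also serves
over `𝕜`. -/
lemma norm_bellNonlinear_sub_le_of_lt {i : ℕ} {δ : ℝ} {x y : ℕ → 𝕜}
    (hx : ∑ j ∈ Finset.range i, ‖x j‖ < δ) (hy : ∑ j ∈ Finset.range i, ‖y j‖ < δ) :
    ‖bellNonlinear i x - bellNonlinear i y‖ ≤
      lipBell i δ * ∑ j ∈ Finset.range i, ‖x j - y j‖ := by
  refine norm_bellNonlinear_sub_le i fun s hs => ?_
  refine (norm_bellNonlinearDeriv_le (fun j => le_rfl) (fun j => le_rfl) i).trans ?_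
  refine (bellNonlinearDeriv_le (δ := δ) ?_).trans (le_of_eq (by simp))
  have : ∑ j ∈ Finset.range i, |‖y j + (s : 𝕜) * (x j - y j)‖| ≤
      (1 - s) * ∑ j ∈ Finset.range i, ‖y j‖ + s * ∑ j ∈ Finset.range i, ‖x j‖ := by
    rw [Finset.mul_sum, Finset.mul_sum, ← Finset.sum_add_distrib]
    refine Finset.sum_le_sum fun j _ => ?_
    rw [abs_norm]
    exact norm_segment_le _ _ hs
  refine this.trans_lt ?_
  rcases hs.1.eq_or_lt with h | h
  · simpa [← h] using hy
  · nlinarith [hs.2]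

/-- The best Lipschitz constant on the real open ball also serves on the complex closed ball. -/
lemma norm_bellNonlinear_sub_le_of_le {i : ℕ} {δ : ℝ} (hδ : 0 < δ) {x y : ℕ → 𝕜}
    (hx : ∑ j ∈ Finset.range i, ‖x j‖ ≤ δ) (hy : ∑ j ∈ Finset.range i, ‖y j‖ ≤ δ) :
    ‖bellNonlinear i x - bellNonlinear i y‖ ≤
      lipBell i δ * ∑ j ∈ Finset.range i, ‖x j - y j‖ := by
  -- Scaling by `s < 1` moves the closed ball into the open one; the inequality then passes to the
  -- limit `s → 1`.
  have hc : ∀ x : ℕ → 𝕜, Tendsto (fun s : ℝ => bellNonlinear i (fun j => (s : 𝕜) * x j))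
      (𝓝[<] 1) (𝓝 (bellNonlinear i x)) := fun x => by
    have := (hasDerivAt_bellNonlinear (fun _ => 0) x 1 i).continuousAt.tendsto
    simp only [zero_add, RCLike.ofReal_one, one_mul] at this
    exact this.mono_left nhdsWithin_le_nhds
  have hs : ∀ s : ℝ, 0 < s → s < 1 → ∀ x : ℕ → 𝕜, ∑ j ∈ Finset.range i, ‖x j‖ ≤ δ →
      ∑ j ∈ Finset.range i, ‖(s : 𝕜) * x j‖ < δ := by
    intro s h0 h1 x hx
    simp only [norm_mul, RCLike.norm_ofReal, abs_of_pos h0, ← Finset.mul_sum]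
    nlinarith
  have hr : Tendsto (fun s : ℝ => lipBell i δ * ∑ j ∈ Finset.range i,
      ‖(s : 𝕜) * x j - (s : 𝕜) * y j‖) (𝓝[<] 1)
      (𝓝 (lipBell i δ * ∑ j ∈ Finset.range i, ‖x j - y j‖)) := by
    have hc : Continuous fun s : ℝ => lipBell i δ * ∑ j ∈ Finset.range i,
      ‖(s : 𝕜) * x j - (s : 𝕜) * y j‖ := by fun_prop
    have := hc.tendsto 1
    simp only [RCLike.ofReal_one, one_mul] at this
    exact this.mono_left nhdsWithin_le_nhds
  refine le_of_tendsto_of_tendsto ((hc x).sub (hc y)).norm hr ?_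
  filter_upwards [Ioo_mem_nhdsLT (show (0 : ℝ) < 1 by norm_num)] with s hs'
  exact norm_bellNonlinear_sub_le_of_lt (hs s hs'.1 hs'.2 x hx) (hs s hs'.1 hs'.2 y hy)

lemma lipMax_nonneg (n : ℕ) (δ : ℝ) : 0 ≤ lipMax n δ :=
  Real.iSup_nonneg fun _ => lipBell_nonneg _ _

lemma norm_bellNonlinear_sub_le_lipMax {n i : ℕ} (hi : i < n) {δ : ℝ} (hδ : 0 < δ) {x y : ℕ → 𝕜}
    (hx : ∑ j ∈ Finset.range (n - 1), ‖x j‖ ≤ δ) (hy : ∑ j ∈ Finset.range (n - 1), ‖y j‖ ≤ δ) :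
    ‖bellNonlinear i x - bellNonlinear i y‖ ≤
      lipMax n δ * ∑ j ∈ Finset.range (n - 1), ‖x j - y j‖ := by
  have hsub : ∀ x : ℕ → 𝕜, ∑ j ∈ Finset.range i, ‖x j‖ ≤ ∑ j ∈ Finset.range (n - 1), ‖x j‖ :=
    fun x => Finset.sum_le_sum_of_subset_of_nonneg
      (Finset.range_subset_range.mpr (by omega)) fun _ _ _ => norm_nonneg _
  rcases i with _ | i
  · rw [bellNonlinear_zero_index, bellNonlinear_zero_index, sub_zero, norm_zero]
    exact mul_nonneg (lipMax_nonneg n δ) (Finset.sum_nonneg fun _ _ => norm_nonneg _)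
  · refine (norm_bellNonlinear_sub_le_of_le hδ ((hsub x).trans hx) ((hsub y).trans hy)).trans ?_
    refine mul_le_mul ?_ (hsub fun j => x j - y j) (Finset.sum_nonneg fun _ _ => norm_nonneg _)
      (lipMax_nonneg n δ)
    exact le_ciSup (f := fun i : Fin (n - 1) => lipBell (i + 1) δ)
      (Set.finite_range _).bddAbove ⟨i, by omega⟩

/-- `B_i` is its last variable plus `f_{i-1}`, and `f_{i-1}` is compared with its value `0` at the
origin. This is the origin of the factor `M (m(M) + 1)`. -/
lemma norm_completeBell_le_lipMax {n i : ℕ} (hi : i < n) (hi0 : i ≠ 0) {δ : ℝ} (hδ : 0 < δ)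
    {x : ℕ → 𝕜} (hx : ∑ j ∈ Finset.range (n - 1), ‖x j‖ ≤ δ) :
    ‖completeBell i x‖ ≤ δ * (lipMax n δ + 1) := by
  obtain ⟨i, rfl⟩ := Nat.exists_eq_succ_of_ne_zero hi0
  have h1 := norm_bellNonlinear_sub_le_lipMax (i := i) (by omega) hδ hx
    (y := fun _ => (0 : 𝕜)) (by simpa using hδ.le)
  rw [bellNonlinear_zero, sub_zero] at h1
  simp only [sub_zero] at h1
  have h2 : ‖x i‖ ≤ δ := (Finset.single_le_sum (f := fun j => ‖x j‖)
    (fun _ _ => norm_nonneg _) (Finset.mem_range.mpr (by omega : i < n - 1))).trans hx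
  rw [Nat.succ_eq_add_one, completeBell_succ_eq]
  refine (norm_add_le _ _).trans ?_
  nlinarith [mul_le_mul_of_nonneg_left hx (lipMax_nonneg n δ)]

end Bell

end PoincarePerron
end

noncomputable section

namespace PoincarePerron

open Polynomial

/-! ### Taylor coefficients of the characteristic polynomial -/

/-- The `j`-th Taylor coefficient of `P(c; ·)` at `x`. -/
def taylorCoeff (n : ℕ) (c : ℕ → ℂ) (j : ℕ) (x : ℂ) : ℂ :=
  ∑ i ∈ Finset.range (n + 1), c i * (Nat.choose i j : ℂ) * x ^ (i - j)

lemma inv_factorial_mul_coeffPolyDeriv (n : ℕ) (c : ℕ → ℂ) (j : ℕ) (x : ℂ) :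
    1 / (Nat.factorial j : ℂ) * coeffPolyDeriv n c j x = taylorCoeff n c j x := by
  have hj : (Nat.factorial j : ℂ) ≠ 0 := Nat.cast_ne_zero.mpr (Nat.factorial_ne_zero j)
  rw [one_div, inv_mul_eq_iff_eq_mul₀ hj, coeffPolyDeriv, ← factorial_smul_hasseDeriv, coeffPoly,
    taylorCoeff]
  rw [LinearMap.coe_smul, Pi.smul_apply, eval_smul, nsmul_eq_mul]
  simp only [map_sum, C_mul_X_pow_eq_monomial, hasseDeriv_monomial, eval_finsetSum, eval_monomial]
  congr 1
  exact Finset.sum_congr rfl fun i _ => by ring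

lemma coeffPolyDeriv_eq (n : ℕ) (c : ℕ → ℂ) (j : ℕ) (x : ℂ) :
    coeffPolyDeriv n c j x = (Nat.factorial j : ℂ) * taylorCoeff n c j x := by
  have hj : (Nat.factorial j : ℂ) ≠ 0 := Nat.cast_ne_zero.mpr (Nat.factorial_ne_zero j)
  rw [← inv_factorial_mul_coeffPolyDeriv]
  field_simp

lemma eval_coeffPoly (n : ℕ) (c : ℕ → ℂ) (x : ℂ) :
    (coeffPoly n c).eval x = ∑ i ∈ Finset.range (n + 1), c i * x ^ i := by
  simp [coeffPoly, eval_finsetSum]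

lemma taylorCoeff_zero (n : ℕ) (c : ℕ → ℂ) (x : ℂ) :
    taylorCoeff n c 0 x = (coeffPoly n c).eval x := by
  simp [taylorCoeff, eval_coeffPoly]

lemma taylorCoeff_self (n : ℕ) (c : ℕ → ℂ) (x : ℂ) : taylorCoeff n c n x = c n := by
  rw [taylorCoeff, Finset.sum_range_succ, Finset.sum_eq_zero fun i hi => ?_]
  · simp
  · simp [Nat.choose_eq_zero_of_lt (Finset.mem_range.mp hi)]

lemma taylorCoeff_add (n : ℕ) (c d : ℕ → ℂ) (j : ℕ) (x : ℂ) :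
    taylorCoeff n (fun i => c i + d i) j x = taylorCoeff n c j x + taylorCoeff n d j x := by
  simp only [taylorCoeff, ← Finset.sum_add_distrib]
  exact Finset.sum_congr rfl fun i _ => by ring

/-- Recognises the inner sum of the nonlinear part `F` as a Taylor coefficient at `x`; the terms of
that coefficient below `j` vanish. -/
lemma sum_range_choose_mul {n j : ℕ} (hj : j ≤ n) (c : ℕ → ℂ) (x : ℂ) :
    ∑ l ∈ Finset.range (n - j + 1), (Nat.choose (j + l) l : ℂ) * c (j + l) * x ^ l =
      taylorCoeff n c j x := by
  rw [taylorCoeff, show n + 1 = j + (n - j + 1) by omega,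
    Finset.sum_range_add _ j (n - j + 1),
    Finset.sum_eq_zero (s := Finset.range j) fun i hi => ?_, zero_add]
  · refine Finset.sum_congr rfl fun l _ => ?_
    rw [Nat.choose_symm_add, Nat.add_sub_cancel_left]
    ring
  · simp [Nat.choose_eq_zero_of_lt (Finset.mem_range.mp hi)]

lemma sum_taylorCoeff_mul_pow (n : ℕ) (c : ℕ → ℂ) (x h : ℂ) :
    ∑ j ∈ Finset.range (n + 1), taylorCoeff n c j x * h ^ j = (coeffPoly n c).eval (h + x) := by
  simp only [taylorCoeff, Finset.sum_mul]
  rw [Finset.sum_comm, eval_coeffPoly]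
  refine Finset.sum_congr rfl fun i hi => ?_
  rw [add_pow, Finset.mul_sum]
  symm
  refine (Finset.sum_congr rfl fun j _ => ?_).trans
    (Finset.sum_subset (Finset.range_subset_range.mpr
      (Nat.succ_le_of_lt (Finset.mem_range.mp hi))) fun j _ hj => ?_)
  · ring
  · rw [Finset.mem_range, not_lt] at hj
    simp [Nat.choose_eq_zero_of_lt hj]

/-- `h⁻¹ (P(a; x + h) - P(a; x))` vanishes when `x` and `x + h` are roots of `P(a; ·)`. -/
lemma sum_taylorCoeff_mul_pow_pred {n : ℕ} {c : ℕ → ℂ} {x h : ℂ} (hx : (coeffPoly n c).IsRoot x)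
    (hxh : (coeffPoly n c).IsRoot (h + x)) (hh : h ≠ 0) :
    ∑ j ∈ Finset.Icc 1 n, taylorCoeff n c j x * h ^ (j - 1) = 0 := by
  have h1 := sum_taylorCoeff_mul_pow n c x h
  rw [hxh.eq_zero, Finset.sum_range_succ', taylorCoeff_zero, hx.eq_zero, zero_mul, add_zero] at h1
  have h2 : ∑ j ∈ Finset.Icc 1 n, taylorCoeff n c j x * h ^ (j - 1) =
      ∑ j ∈ Finset.range n, taylorCoeff n c (j + 1) x * h ^ j := by
    have := Finset.sum_Ico_add' (fun j => taylorCoeff n c j x * h ^ (j - 1)) 0 n 1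
    simp only [Nat.add_sub_cancel] at this
    rw [Finset.range_eq_Ico, this]
    rfl
  rw [h2]
  refine (mul_eq_zero.mp (?_ : h * _ = 0)).resolve_left hh
  rw [← h1, Finset.mul_sum]
  exact Finset.sum_congr rfl fun j _ => by ring

/-- The factor `e^{-xt - S} (e^{xt + S})^(i)` in terms of the derivatives of `S`. -/
def bellShift (i : ℕ) (x : ℂ) (Z : ℕ → ℂ) : ℂ :=
  ∑ j ∈ Finset.range (i + 1), (Nat.choose i j : ℂ) * x ^ (i - j) * completeBell j Z

/-- Interchanging the two sums moves the binomial factors from the derivatives of the exponential to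
the polynomial `P(c; ·)`. -/
lemma sum_mul_bellShift (n : ℕ) (c : ℕ → ℂ) (x : ℂ) (Z : ℕ → ℂ) :
    ∑ i ∈ Finset.range (n + 1), c i * bellShift i x Z =
      ∑ j ∈ Finset.range (n + 1), taylorCoeff n c j x * completeBell j Z := by
  simp only [taylorCoeff, Finset.sum_mul, bellShift, Finset.mul_sum]
  rw [Finset.sum_comm' (t' := Finset.range (n + 1))
    (s' := fun j => (Finset.range (n + 1)).filter fun i => j ≤ i)]
  · refine Finset.sum_congr rfl fun j _ => ?_
    rw [Finset.sum_filter]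
    refine Finset.sum_congr rfl fun i _ => ?_
    split_ifs with h
    · ring
    · simp [Nat.choose_eq_zero_of_lt (not_le.mp h)]
  · intro i j
    simp only [Finset.mem_range, Finset.mem_filter]
    omega

/-- The right hand side of the Riccati type equation as a function of time and of the sequence
of derivatives of the unknown. -/
def riccatiRhsSeq (n : ℕ) (a : ℕ → ℂ) (r : ℕ → ℝ → ℂ) (x : ℂ) (t : ℝ) (Z : ℕ → ℂ) : ℂ :=
  pertTerm n r x t +
  ∑ k ∈ Finset.Icc 1 (n - 1),
    (1 / (Nat.factorial k : ℂ)) * coeffPolyDeriv n (fun i => r i t) k x * Z (k - 1) +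
  ∑ i ∈ Finset.Icc 2 n, ∑ j ∈ Finset.range (n - i + 1),
    (Nat.choose (i + j) j : ℂ) * (a (i + j) + r (i + j) t) * x ^ j * bellNonlinear (i - 1) Z

lemma riccatiRhs_eq (n : ℕ) (a : ℕ → ℂ) (r : ℕ → ℝ → ℂ) (x : ℂ) (z : ℝ → ℂ) (t : ℝ) :
    riccatiRhs n a r x z t = riccatiRhsSeq n a r x t (fun l => iteratedDeriv l z t) := rfl

lemma riccatiRhsSeq_congr {n : ℕ} (a : ℕ → ℂ) (r : ℕ → ℝ → ℂ) (x : ℂ) (t : ℝ) {Z W : ℕ → ℂ}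
    (h : ∀ j < n - 1, Z j = W j) : riccatiRhsSeq n a r x t Z = riccatiRhsSeq n a r x t W := by
  unfold riccatiRhsSeq
  congr 1
  · congr 1
    refine Finset.sum_congr rfl fun k hk => ?_
    rw [Finset.mem_Icc] at hk
    rw [h (k - 1) (by omega)]
  · refine Finset.sum_congr rfl fun i hi => Finset.sum_congr rfl fun j _ => ?_
    rw [Finset.mem_Icc] at hi
    rw [bellNonlinear_congr (i - 1) fun l hl => h l (by omega)]

/-- The right side is equation (1) divided by `y` when `y'/y = x + z`. Regrouped by Taylor
coefficients, its constant term loses `P(a; x) = 0`, and `B_j = x_j + f_{j-1}` separates the linear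
part from the nonlinear one. -/
lemma linConst_add_riccatiRhsSeq {n : ℕ} (hn : 2 ≤ n) {a : ℕ → ℂ} {r : ℕ → ℝ → ℂ} {x : ℂ}
    (hrn : r n = 0) (hx : (coeffPoly n a).IsRoot x) (t : ℝ) (Z : ℕ → ℂ) :
    ∑ j ∈ Finset.Icc 1 n, taylorCoeff n a j x * Z (j - 1) + riccatiRhsSeq n a r x t Z =
      ∑ i ∈ Finset.range (n + 1), (a i + r i t) * bellShift i x Z := by
  set T := taylorCoeff n (fun i => a i + r i t) with hT
  have hlin : ∀ j, T j x = taylorCoeff n a j x + taylorCoeff n (fun i => r i t) j x :=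
    fun j => taylorCoeff_add n _ _ j x
  have hIcc : ∀ F : ℕ → ℂ, ∑ j ∈ Finset.range (n + 1), F j = F 0 + ∑ j ∈ Finset.Icc 1 n, F j := by
    intro F
    rw [Finset.range_eq_Ico, Finset.sum_eq_sum_Ico_succ_bot (by omega)]
    rfl
  -- The term `k = n` carries the coefficient `r_n = 0`, so the range may be extended.
  have hlast : ∑ k ∈ Finset.Icc 1 (n - 1), taylorCoeff n (fun i => r i t) k x * Z (k - 1) =
      ∑ k ∈ Finset.Icc 1 n, taylorCoeff n (fun i => r i t) k x * Z (k - 1) := by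
    obtain ⟨m, rfl⟩ := Nat.exists_eq_add_of_le' (show 1 ≤ n by omega)
    rw [Nat.add_sub_cancel, Finset.sum_Icc_succ_top (by omega), taylorCoeff_self, hrn]
    simp
  -- Since `f_0 = 0`, a term for `i = 1` may be added.
  have hnonlin : ∑ i ∈ Finset.Icc 2 n, ∑ j ∈ Finset.range (n - i + 1),
      (Nat.choose (i + j) j : ℂ) * (a (i + j) + r (i + j) t) * x ^ j * bellNonlinear (i - 1) Z =
      ∑ j ∈ Finset.Icc 1 n, T j x * bellNonlinear (j - 1) Z := by
    rw [← Finset.add_sum_Ioc_eq_sum_Icc (show 1 ≤ n by omega), Nat.sub_self,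
      bellNonlinear_zero_index, mul_zero, zero_add]
    refine Finset.sum_congr rfl fun i hi => ?_
    rw [← Finset.sum_mul]
    congr 1
    exact sum_range_choose_mul (Finset.mem_Icc.mp hi).2 (fun i => a i + r i t) x
  rw [sum_mul_bellShift, hIcc, ← hT, hlin 0, taylorCoeff_zero, taylorCoeff_zero, hx.eq_zero,
    zero_add]
  unfold riccatiRhsSeq
  simp only [inv_factorial_mul_coeffPolyDeriv]
  rw [hlast, hnonlin, pertTerm]
  have : ∑ j ∈ Finset.Icc 1 n, T j x * completeBell j Z = ∑ j ∈ Finset.Icc 1 n,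
      (taylorCoeff n a j x * Z (j - 1) + taylorCoeff n (fun i => r i t) j x * Z (j - 1) +
        T j x * bellNonlinear (j - 1) Z) := by
    refine Finset.sum_congr rfl fun j hj => ?_
    obtain ⟨m, rfl⟩ := Nat.exists_eq_add_of_le' (Finset.mem_Icc.mp hj).1
    rw [completeBell_succ_eq, Nat.add_sub_cancel, mul_add]
    nth_rw 1 [hlin]
    ring
  rw [this, Finset.sum_add_distrib, Finset.sum_add_distrib]
  simp only [completeBell]
  ring

/-- Taking `i + j` as the new outer index passes from the indexing of `F` to that of `constQ`. -/
lemma sum_Icc_sum_range_shift {M : Type*} [AddCommMonoid M] (n : ℕ) (F : ℕ → ℕ → M) :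
    ∑ i ∈ Finset.Icc 2 n, ∑ j ∈ Finset.range (n - i + 1), F (i + j) j =
      ∑ i ∈ Finset.Icc 2 n, ∑ l ∈ Finset.range (i - 1), F i l := by
  rw [Finset.sum_sigma', Finset.sum_sigma']
  refine Finset.sum_bij' (fun p _ => ⟨p.1 + p.2, p.2⟩) (fun p _ => ⟨p.1 - p.2, p.2⟩) ?_ ?_ ?_ ?_ ?_
  · rintro ⟨i, j⟩ h
    simp only [Finset.mem_sigma, Finset.mem_Icc, Finset.mem_range] at h ⊢
    omega
  · rintro ⟨i, j⟩ h
    simp only [Finset.mem_sigma, Finset.mem_Icc, Finset.mem_range] at h ⊢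
    omega
  · rintro ⟨i, j⟩ h
    simp
  · rintro ⟨i, j⟩ h
    simp only [Finset.mem_sigma, Finset.mem_Icc, Finset.mem_range] at h
    simp only [Sigma.mk.injEq, heq_eq_eq, and_true]
    omega
  · rintro ⟨i, j⟩ h
    rfl

/-! ### Partial fractions -/

section PartialFractions

variable {n : ℕ} {lam : Fin n → ℂ}

lemma gammaProd_eq (lam : Fin n → ℂ) (k j : Fin n) :
    gammaProd lam k j = ∏ l ∈ (Finset.univ.erase k).erase j, (lam j - lam l) := by
  simp [gammaProd, gammaRoot]

/-- The sum is the coefficient of `X^(n-2)` in the Lagrange interpolation of `X^i` at the `n - 1`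
nodes `γ_kj`, which reproduces `X^i`. -/
lemma sum_pow_div_gammaProd (hlam : Function.Injective lam) (k : Fin n) {i : ℕ} (hi : i < n - 1) :
    ∑ j ∈ Finset.univ.erase k, gammaRoot lam k j ^ i / gammaProd lam k j =
      if i = n - 2 then 1 else 0 := by
  have hcard : (Finset.univ.erase k).card = n - 1 := by simp
  have hinj : Set.InjOn (gammaRoot lam k) (Finset.univ.erase k : Finset (Fin n)) :=
    fun j _ l _ h => hlam (sub_left_injective h)
  have := Lagrange.coeff_eq_sum hinj (P := (X : ℂ[X]) ^ i)
    (by rw [degree_X_pow, hcard]; exact_mod_cast hi)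
  simp only [eval_pow, eval_X, hcard, coeff_X_pow] at this
  unfold gammaProd
  rw [← this]
  congr 1
  exact propext (by omega)

lemma gammaRoot_ne_zero (hlam : Function.Injective lam) {k j : Fin n} (h : j ≠ k) :
    gammaRoot lam k j ≠ 0 := sub_ne_zero.mpr (hlam.ne h)

/-- Interpolate the constant `1` at all `n` nodes `λ_j`: its coefficient of `X^(n-1)` is zero, so
the term of the node `λ_k` equals minus the sum of the others. Reversing `n - 1` differences gives
the remaining sign. -/
lemma sum_inv_gammaProd_mul_gammaRoot (hlam : Function.Injective lam) (hn : 2 ≤ n) (k : Fin n) :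
    ∑ j ∈ Finset.univ.erase k, 1 / (gammaProd lam k j * gammaRoot lam k j) =
      (-1) ^ n * ∏ j ∈ Finset.univ.erase k, (lam j - lam k)⁻¹ := by
  have := Lagrange.coeff_eq_sum (s := Finset.univ) (v := lam) hlam.injOn (P := (1 : ℂ[X]))
    (by rw [degree_one, Finset.card_univ, Fintype.card_fin]; exact_mod_cast (by omega : 0 < n))
  rw [Finset.card_univ, Fintype.card_fin, coeff_one, if_neg (by omega),
    ← Finset.add_sum_erase _ _ (Finset.mem_univ k)] at this
  have h1 : ∀ j ∈ Finset.univ.erase k, eval (lam j) (1 : ℂ[X]) /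
      ∏ l ∈ Finset.univ.erase j, (lam j - lam l) = 1 / (gammaProd lam k j * gammaRoot lam k j) := by
    intro j hj
    have hjk := Finset.ne_of_mem_erase hj
    rw [eval_one, gammaProd_eq, gammaRoot, Finset.erase_right_comm,
      Finset.prod_erase_mul _ _ (Finset.mem_erase.mpr ⟨hjk.symm, Finset.mem_univ k⟩)]
  rw [Finset.sum_congr rfl h1, eval_one, one_div, ← Finset.prod_inv_distrib] at this
  have h2 : ∏ l ∈ Finset.univ.erase k, (lam k - lam l)⁻¹ =
      (-1) ^ (n - 1) * ∏ l ∈ Finset.univ.erase k, (lam l - lam k)⁻¹ := by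
    have hcard : (Finset.univ.erase k).card = n - 1 := by simp
    rw [← hcard, ← Finset.prod_const, ← Finset.prod_mul_distrib]
    refine Finset.prod_congr rfl fun l _ => ?_
    rw [← neg_sub, inv_neg, neg_one_mul]
  obtain ⟨m, rfl⟩ := Nat.exists_eq_add_of_le' (show 1 ≤ n by omega)
  rw [h2, Nat.add_sub_cancel] at this
  rw [pow_succ]
  linear_combination -this

end PartialFractions

end PoincarePerron
end

noncomputable section

namespace PoincarePerron

open MeasureTheory

/-! ### Bounded continuous functions on the line -/

/-- `f` is continuous and bounded. -/
def BddCont {E : Type*} [NormedAddCommGroup E] (f : ℝ → E) : Prop :=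
  Continuous f ∧ ∃ B, ∀ t, ‖f t‖ ≤ B

namespace BddCont

lemma const {E : Type*} [NormedAddCommGroup E] (c : E) : BddCont fun _ : ℝ => c :=
  ⟨continuous_const, ‖c‖, fun _ => le_rfl⟩

lemma add {E : Type*} [NormedAddCommGroup E] {f g : ℝ → E} (hf : BddCont f) (hg : BddCont g) :
    BddCont fun t => f t + g t := by
  obtain ⟨B, hB⟩ := hf.2
  obtain ⟨C, hC⟩ := hg.2
  exact ⟨hf.1.add hg.1, B + C, fun t => norm_add_le_of_le (hB t) (hC t)⟩

lemma mul {R : Type*} [NormedRing R] {f g : ℝ → R} (hf : BddCont f) (hg : BddCont g) :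
    BddCont fun t => f t * g t := by
  obtain ⟨B, hB⟩ := hf.2
  obtain ⟨C, hC⟩ := hg.2
  exact ⟨hf.1.mul hg.1, B * C, fun t => (norm_mul_le _ _).trans
    (mul_le_mul (hB t) (hC t) (norm_nonneg _) ((norm_nonneg _).trans (hB t)))⟩

lemma norm {E : Type*} [NormedAddCommGroup E] {f : ℝ → E} (hf : BddCont f) :
    BddCont fun t => ‖f t‖ :=
  ⟨hf.1.norm, hf.2.imp fun B hB t => by simpa using hB t⟩

lemma sum {E : Type*} [NormedAddCommGroup E] {ι : Type*} (s : Finset ι) {f : ι → ℝ → E}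
    (hf : ∀ i ∈ s, BddCont (f i)) : BddCont fun t => ∑ i ∈ s, f i t := by
  classical
  induction s using Finset.induction_on with
  | empty => simpa using const (0 : E)
  | insert i s hi ih =>
    simp only [Finset.sum_insert hi]
    exact (hf i (Finset.mem_insert_self _ _)).add
      (ih fun j hj => hf j (Finset.mem_insert_of_mem hj))

lemma shift {E : Type*} [NormedAddCommGroup E] {f : ℝ → E} (hf : BddCont f) (c : ℝ) :
    BddCont fun t => f (t + c) :=
  ⟨hf.1.comp (by fun_prop), hf.2.imp fun B hB t => hB _⟩

lemma completeBell {Z : ℝ → ℕ → ℂ} (hZ : ∀ j, BddCont fun t => Z t j) :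
    ∀ i : ℕ, BddCont fun t => completeBell i (Z t)
  | 0 => by simpa [PoincarePerron.completeBell] using const (1 : ℂ)
  | i + 1 => by
    simp only [PoincarePerron.completeBell]
    exact sum _ fun j _ => ((const _).mul (completeBell hZ (i - j))).mul (hZ j)

lemma bellNonlinear {Z : ℝ → ℕ → ℂ} (hZ : ∀ j, BddCont fun t => Z t j) (i : ℕ) :
    BddCont fun t => bellNonlinear i (Z t) := by
  simp only [bellNonlinear_eq_sum]
  exact sum _ fun j _ => ((const _).mul (completeBell hZ (i - j))).mul (hZ j)

lemma taylorCoeff {n : ℕ} {r : ℕ → ℝ → ℂ} (hr : ∀ i ≤ n, BddCont (r i)) (j : ℕ) (x : ℂ) :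
    BddCont fun t => taylorCoeff n (fun i => r i t) j x :=
  sum _ fun i hi => ((hr i (by simpa [Nat.lt_succ_iff] using hi)).mul (const _)).mul (const _)

lemma coeffPolyDeriv {n : ℕ} {r : ℕ → ℝ → ℂ} (hr : ∀ i ≤ n, BddCont (r i)) (j : ℕ) (x : ℂ) :
    BddCont fun t => coeffPolyDeriv n (fun i => r i t) j x := by
  simp only [coeffPolyDeriv_eq]
  exact (const _).mul (taylorCoeff hr j x)

lemma pertTerm {n : ℕ} {r : ℕ → ℝ → ℂ} (hr : ∀ i ≤ n, BddCont (r i)) (x : ℂ) :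
    BddCont (pertTerm n r x) := by
  have := taylorCoeff hr 0 x
  simp only [taylorCoeff_zero] at this
  exact this

lemma riccatiRhsSeq {n : ℕ} (a : ℕ → ℂ) {r : ℕ → ℝ → ℂ} (hr : ∀ i ≤ n, BddCont (r i)) (x : ℂ)
    {Z : ℝ → ℕ → ℂ} (hZ : ∀ j, BddCont fun t => Z t j) :
    BddCont fun t => riccatiRhsSeq n a r x t (Z t) := by
  refine ((pertTerm hr x).add (sum _ fun k _ => ?_)).add (sum _ fun i hi => sum _ fun j hj => ?_)
  · exact ((const _).mul (coeffPolyDeriv hr k x)).mul (hZ _)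
  · rw [Finset.mem_Icc] at hi
    rw [Finset.mem_range] at hj
    exact ((((const _).mul ((const _).add (hr _ (by omega)))).mul (const _))).mul
      (bellNonlinear hZ _)

end BddCont

/-! ### The integral operators `I_α` -/

lemma absGreenOp_eq (α : ℝ) {E : Type*} [NormedAddCommGroup E] (f : ℝ → ℂ) (g : ℝ → E)
    (h : ∀ s, ‖f s‖ = ‖g s‖) (t : ℝ) :
    absGreenOp (α : ℂ) f t = ∫ s, ‖greenKernel (α : ℂ) t s‖ * ‖g s‖ := by
  simp [absGreenOp, h]

lemma integrable_norm_greenKernel_mul {α : ℝ} (hα : α ≠ 0) {g : ℝ → ℝ} (hg : BddCont g) (t : ℝ) :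
    Integrable fun s => ‖greenKernel (α : ℂ) t s‖ * g s := by
  obtain ⟨B, hB⟩ := hg.2
  exact (integrable_greenKernel (ω := (α : ℂ)) (by simpa using hα) t).norm.mul_bdd
    hg.1.aestronglyMeasurable (Filter.Eventually.of_forall hB)

/-- Boundedness of `f` bounds the range, without which the real supremum would be a default value.
-/
lemma absGreenOp_le_supNorm {α : ℝ} (hα : α ≠ 0) {f : ℝ → ℂ} (hf : BddCont f) (t : ℝ) :
    absGreenOp (α : ℂ) f t ≤ supNorm (absGreenOp (α : ℂ) f) := by
  obtain ⟨B, hB⟩ := hf.2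
  have hbdd : BddAbove (Set.range fun t => ‖absGreenOp (α : ℂ) f t‖) := by
    refine ⟨1 / |α| * B, ?_⟩
    rintro _ ⟨t, rfl⟩
    have h0 : 0 ≤ absGreenOp (α : ℂ) f t := integral_nonneg fun s => norm_nonneg _
    simp only [Real.norm_eq_abs, abs_of_nonneg h0]
    rw [absGreenOp_eq α f f (fun _ => rfl)]
    refine (integral_mono (integrable_norm_greenKernel_mul hα hf.norm t)
      ((integrable_greenKernel (ω := (α : ℂ)) (by simpa using hα) t).norm.mul_const B)
      fun s => mul_le_mul_of_nonneg_left (hB s) (norm_nonneg _)).trans ?_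
    rw [integral_mul_const, integral_norm_greenKernel (by simpa using hα), Complex.ofReal_re]
  exact (le_abs_self _).trans (le_ciSup hbdd t)

/-! ### Derivatives of the Green operator `G^{λ_k}` -/

/-- A chain of functions, each the derivative of the previous one, consists of the iterated
derivatives of its first member. -/
lemma iteratedDeriv_eq_of_hasDerivAt {E : Type*} [NormedAddCommGroup E] [NormedSpace ℝ E] {m : ℕ}
    {F : ℕ → ℝ → E} (hF : ∀ i < m, ∀ t, HasDerivAt (F i) (F (i + 1) t) t) {i : ℕ} (hi : i ≤ m) :
    iteratedDeriv i (F 0) = F i := by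
  induction i with
  | zero => simp
  | succ i ih =>
    rw [iteratedDeriv_succ, ih (by omega)]
    exact funext fun t => (hF i (by omega) t).deriv

lemma contDiff_of_hasDerivAt {E : Type*} [NormedAddCommGroup E] [NormedSpace ℝ E] {m : ℕ}
    {F : ℕ → ℝ → E} (hF : ∀ i < m, ∀ t, HasDerivAt (F i) (F (i + 1) t) t)
    (hm : Continuous (F m)) : ContDiff ℝ (m : WithTop ℕ∞) (F 0) := by
  refine contDiff_nat_iff_iteratedDeriv.mpr ⟨fun i hi => ?_, fun i hi => ?_⟩
  · rw [iteratedDeriv_eq_of_hasDerivAt hF hi]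
    rcases hi.eq_or_lt with rfl | hi
    · exact hm
    · exact continuous_iff_continuousAt.mpr fun t => (hF i hi t).continuousAt
  · rw [iteratedDeriv_eq_of_hasDerivAt hF hi.le]
    exact fun t => (hF i hi t).differentiableAt

section Green

variable {n : ℕ} {lam : Fin n → ℂ}

/-- The sum `∑_{j ≠ k} γ_{kj}^i Γ_{kj}⁻¹ G_{γ_{kj}}[f]`, which is the `i`-th derivative of
`G^{λ_k}[f]` for `i ≤ n - 2`. -/
def greenRootDeriv (lam : Fin n → ℂ) (k : Fin n) (i : ℕ) (f : ℝ → ℂ) (t : ℝ) : ℂ :=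
  ∑ j ∈ Finset.univ.erase k,
    gammaRoot lam k j ^ i / gammaProd lam k j * greenOp (gammaRoot lam k j) f t

lemma greenRootDeriv_zero (lam : Fin n → ℂ) (k : Fin n) :
    greenRootDeriv lam k 0 = greenRoot lam k := by
  funext f t
  simp [greenRootDeriv, greenRoot]

lemma greenRootDeriv_shift (lam : Fin n → ℂ) (k : Fin n) (i : ℕ) (f : ℝ → ℂ) (t c : ℝ) :
    greenRootDeriv lam k i (fun s => f (s + c)) t = greenRootDeriv lam k i f (t + c) := by
  simp only [greenRootDeriv, greenOp_shift]

lemma alphaRe_ne_zero (hre : ∀ i j, i ≠ j → (lam i).re ≠ (lam j).re) {k j : Fin n}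
    (hj : j ∈ Finset.univ.erase k) : alphaRe lam k j ≠ 0 := by
  simpa [alphaRe, gammaRoot, sub_eq_zero] using hre j k (Finset.ne_of_mem_erase hj)

lemma injective_of_re (hre : ∀ i j, i ≠ j → (lam i).re ≠ (lam j).re) :
    Function.Injective lam := fun i j h => by
  by_contra hij
  exact hre i j hij (congrArg Complex.re h)

lemma greenRootDeriv_sub (hre : ∀ i j, i ≠ j → (lam i).re ≠ (lam j).re) (k : Fin n) (i : ℕ)
    {f g : ℝ → ℂ} (hf : BddCont f) (hg : BddCont g) (t : ℝ) :
    greenRootDeriv lam k i f t - greenRootDeriv lam k i g t =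
      greenRootDeriv lam k i (fun s => f s - g s) t := by
  obtain ⟨B, hB⟩ := hf.2
  obtain ⟨C, hC⟩ := hg.2
  simp only [greenRootDeriv, ← Finset.sum_sub_distrib]
  refine Finset.sum_congr rfl fun j hj => ?_
  rw [greenOp_sub (alphaRe_ne_zero hre hj) hf.1 hg.1 hB hC]
  ring

/-- Every summand contributes a multiple of `f t`. By `sum_pow_div_gammaProd` these cancel until `i
= n - 2`, where their weights add up to one. -/
lemma hasDerivAt_greenRootDeriv (hre : ∀ i j, i ≠ j → (lam i).re ≠ (lam j).re) (k : Fin n)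
    {i : ℕ} (hi : i < n - 1) {f : ℝ → ℂ} (hf : BddCont f) (t : ℝ) :
    HasDerivAt (greenRootDeriv lam k i f)
      ((if i = n - 2 then f t else 0) + greenRootDeriv lam k (i + 1) f t) t := by
  obtain ⟨B, hB⟩ := hf.2
  have h := HasDerivAt.fun_sum (u := Finset.univ.erase k) fun j hj =>
    (hasDerivAt_greenOp (alphaRe_ne_zero hre hj) hf.1 hB t).const_mul
      (gammaRoot lam k j ^ i / gammaProd lam k j)
  refine h.congr_deriv ?_
  simp only [mul_add, Finset.sum_add_distrib, ← Finset.sum_mul,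
    sum_pow_div_gammaProd (injective_of_re hre) k hi, ite_mul, one_mul, zero_mul]
  congr 1
  exact Finset.sum_congr rfl fun j _ => by rw [pow_succ]; ring

lemma continuous_greenRootDeriv (hre : ∀ i j, i ≠ j → (lam i).re ≠ (lam j).re) (k : Fin n)
    (i : ℕ) {f : ℝ → ℂ} (hf : BddCont f) : Continuous (greenRootDeriv lam k i f) := by
  obtain ⟨B, hB⟩ := hf.2
  refine continuous_finsetSum _ fun j hj => continuous_const.mul ?_
  exact continuous_iff_continuousAt.mpr fun t =>
    (hasDerivAt_greenOp (alphaRe_ne_zero hre hj) hf.1 hB t).continuousAt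

/-- The chain of derivatives of `G^{λ_k}[f]` up to order `n - 1`. -/
def greenRootChain (lam : Fin n → ℂ) (k : Fin n) (f : ℝ → ℂ) (i : ℕ) (t : ℝ) : ℂ :=
  (if i = n - 1 then f t else 0) + greenRootDeriv lam k i f t

lemma hasDerivAt_greenRootChain (hre : ∀ i j, i ≠ j → (lam i).re ≠ (lam j).re) (hn : 2 ≤ n)
    (k : Fin n) {f : ℝ → ℂ} (hf : BddCont f) :
    ∀ i < n - 1, ∀ t,
      HasDerivAt (greenRootChain lam k f i) (greenRootChain lam k f (i + 1) t) t := by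
  intro i hi t
  have h1 : greenRootChain lam k f i = greenRootDeriv lam k i f := by
    funext s
    simp [greenRootChain, hi.ne]
  have h2 : i + 1 = n - 1 ↔ i = n - 2 := by omega
  rw [h1, greenRootChain]
  simp only [h2]
  exact hasDerivAt_greenRootDeriv hre k hi hf t

lemma greenRootChain_zero (hn : 2 ≤ n) (lam : Fin n → ℂ) (k : Fin n) (f : ℝ → ℂ) :
    greenRootChain lam k f 0 = greenRoot lam k f := by
  funext t
  rw [greenRootChain, if_neg (by omega), zero_add, greenRootDeriv_zero]

lemma iteratedDeriv_greenRoot (hre : ∀ i j, i ≠ j → (lam i).re ≠ (lam j).re) (hn : 2 ≤ n)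
    (k : Fin n) {f : ℝ → ℂ} (hf : BddCont f) {i : ℕ} (hi : i ≤ n - 1) :
    iteratedDeriv i (greenRoot lam k f) = greenRootChain lam k f i := by
  rw [← greenRootChain_zero hn]
  exact iteratedDeriv_eq_of_hasDerivAt (hasDerivAt_greenRootChain hre hn k hf) hi

lemma iteratedDeriv_greenRoot_of_lt (hre : ∀ i j, i ≠ j → (lam i).re ≠ (lam j).re) (hn : 2 ≤ n)
    (k : Fin n) {f : ℝ → ℂ} (hf : BddCont f) {i : ℕ} (hi : i < n - 1) :
    iteratedDeriv i (greenRoot lam k f) = greenRootDeriv lam k i f := by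
  rw [iteratedDeriv_greenRoot hre hn k hf hi.le]
  funext t
  simp [greenRootChain, hi.ne]

lemma contDiff_greenRoot (hre : ∀ i j, i ≠ j → (lam i).re ≠ (lam j).re) (hn : 2 ≤ n)
    (k : Fin n) {f : ℝ → ℂ} (hf : BddCont f) :
    ContDiff ℝ ((n - 1 : ℕ) : WithTop ℕ∞) (greenRoot lam k f) := by
  rw [← greenRootChain_zero hn]
  refine contDiff_of_hasDerivAt (hasDerivAt_greenRootChain hre hn k hf) ?_
  have : greenRootChain lam k f (n - 1) = fun t => f t + greenRootDeriv lam k (n - 1) f t := by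
    funext t
    simp [greenRootChain]
  rw [this]
  exact hf.1.add (continuous_greenRootDeriv hre k _ hf)

/-- `G^{λ_k}` is a right inverse of the constant coefficient operator. -/
lemma linConst_greenRoot (hre : ∀ i j, i ≠ j → (lam i).re ≠ (lam j).re) (hn : 2 ≤ n)
    {a : ℕ → ℂ} (ha : a n = 1) (hroot : ∀ k, (coeffPoly n a).IsRoot (lam k)) (k : Fin n)
    {f : ℝ → ℂ} (hf : BddCont f) (t : ℝ) :
    linConst n a (lam k) (greenRoot lam k f) t = f t := by
  have h1 : linConst n a (lam k) (greenRoot lam k f) t = ∑ j ∈ Finset.Icc 1 n,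
      (taylorCoeff n a j (lam k) * (if j = n then f t else 0) +
        taylorCoeff n a j (lam k) * greenRootDeriv lam k (j - 1) f t) := by
    refine Finset.sum_congr rfl fun j hj => ?_
    rw [Finset.mem_Icc] at hj
    rw [inv_factorial_mul_coeffPolyDeriv, iteratedDeriv_greenRoot hre hn k hf (by omega),
      greenRootChain, ← mul_add]
    have : j - 1 = n - 1 ↔ j = n := by omega
    simp only [this]
  -- Each `γ_kl` is a root of the characteristic polynomial `h⁻¹ (P(a; λ_k + h) - P(a; λ_k))` of
  -- `D_k`, so only the extra `f t` at `j = n` survives.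
  have h2 : ∑ j ∈ Finset.Icc 1 n,
      taylorCoeff n a j (lam k) * greenRootDeriv lam k (j - 1) f t = 0 := by
    simp only [greenRootDeriv, Finset.mul_sum]
    rw [Finset.sum_comm]
    refine Finset.sum_eq_zero fun l hl => ?_
    have h3 := sum_taylorCoeff_mul_pow_pred (h := gammaRoot lam k l) (hroot k)
      (by simpa [gammaRoot] using hroot l)
      (gammaRoot_ne_zero (injective_of_re hre) (Finset.ne_of_mem_erase hl))
    rw [← zero_mul (greenOp (gammaRoot lam k l) f t / gammaProd lam k l), ← h3, Finset.sum_mul]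
    exact Finset.sum_congr rfl fun j _ => by ring
  rw [h1, Finset.sum_add_distrib, h2, add_zero]
  simp only [mul_ite, mul_zero]
  rw [Finset.sum_ite_eq' (Finset.Icc 1 n) n, if_pos (Finset.mem_Icc.mpr ⟨by omega, le_rfl⟩),
    taylorCoeff_self, ha, one_mul]

lemma sum_norm_greenRootDeriv_le (lam : Fin n → ℂ) (k : Fin n) (f : ℝ → ℂ) (t : ℝ) :
    ∑ i ∈ Finset.range (n - 1), ‖greenRootDeriv lam k i f t‖ ≤
      ∑ j ∈ Finset.univ.erase k,
        alphaTilde lam k j / ‖gammaProd lam k j‖ * ‖greenOp (gammaRoot lam k j) f t‖ := by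
  have h : ∀ i ∈ Finset.range (n - 1), ‖greenRootDeriv lam k i f t‖ ≤
      ∑ j ∈ Finset.univ.erase k, ‖gammaRoot lam k j‖ ^ i / ‖gammaProd lam k j‖ *
        ‖greenOp (gammaRoot lam k j) f t‖ := fun i _ =>
    norm_sum_le_of_le _ fun j _ => by rw [norm_mul, norm_div, norm_pow]
  refine (Finset.sum_le_sum h).trans (le_of_eq ?_)
  rw [Finset.sum_comm]
  refine Finset.sum_congr rfl fun j _ => ?_
  rw [← Finset.sum_mul, ← Finset.sum_div, alphaTilde]

/-- The operator norm of `G^{λ_k}` from bounded functions to `C^{n-2}` is at most this constant. -/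
def greenRootBound (lam : Fin n → ℂ) (k : Fin n) : ℝ :=
  ∑ j ∈ Finset.univ.erase k,
    alphaTilde lam k j / ‖gammaProd lam k j‖ * (1 / |alphaRe lam k j|)

lemma alphaTilde_nonneg (lam : Fin n → ℂ) (k j : Fin n) : 0 ≤ alphaTilde lam k j :=
  Finset.sum_nonneg fun _ _ => by positivity

lemma greenRootBound_nonneg (lam : Fin n → ℂ) (k : Fin n) : 0 ≤ greenRootBound lam k :=
  Finset.sum_nonneg fun j _ => by have := alphaTilde_nonneg lam k j; positivity

lemma sum_norm_greenRootDeriv_le_bound (hre : ∀ i j, i ≠ j → (lam i).re ≠ (lam j).re)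
    (k : Fin n) {f : ℝ → ℂ} {B : ℝ} (hB : ∀ s, ‖f s‖ ≤ B) (t : ℝ) :
    ∑ i ∈ Finset.range (n - 1), ‖greenRootDeriv lam k i f t‖ ≤ greenRootBound lam k * B := by
  refine (sum_norm_greenRootDeriv_le lam k f t).trans ?_
  rw [greenRootBound, Finset.sum_mul]
  refine Finset.sum_le_sum fun j hj => ?_
  rw [mul_assoc]
  have := alphaTilde_nonneg lam k j
  exact mul_le_mul_of_nonneg_left (norm_greenOp_le (alphaRe_ne_zero hre hj) hB t) (by positivity)

end Green

end PoincarePerron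
end

noncomputable section

namespace PoincarePerron

open MeasureTheory Filter

/-! ### Lipschitz estimate for the right hand side of the Riccati type equation -/

/-- A Lipschitz constant at time `t` of `riccatiRhsSeq`, given a Lipschitz constant `m` of the
polynomials `f_i`. -/
def riccatiLip (n : ℕ) (a : ℕ → ℂ) (r : ℕ → ℝ → ℂ) (x : ℂ) (m : ℝ) (t : ℝ) : ℝ :=
  ∑ l ∈ Finset.Icc 1 (n - 1),
    1 / (Nat.factorial l : ℝ) * ‖coeffPolyDeriv n (fun i => r i t) l x‖ +
  m * ∑ i ∈ Finset.Icc 2 n, ∑ l ∈ Finset.range (i - 1),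
    (Nat.choose i l : ℝ) * ‖x‖ ^ l * (‖a i‖ + ‖r i t‖)

lemma bddCont_riccatiLip {n : ℕ} (a : ℕ → ℂ) {r : ℕ → ℝ → ℂ} (hr : ∀ i ≤ n, BddCont (r i)) (x : ℂ)
    (m : ℝ) : BddCont (riccatiLip n a r x m) := by
  refine (BddCont.sum _ fun l _ => ?_).add ((BddCont.const m).mul
    (BddCont.sum _ fun i hi => BddCont.sum _ fun l _ => ?_))
  · exact (BddCont.const _).mul (BddCont.coeffPolyDeriv hr l x).norm
  · exact (BddCont.const _).mul ((BddCont.const _).add (hr i (Finset.mem_Icc.mp hi).2).norm)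

lemma norm_riccatiRhsSeq_sub_le (n : ℕ) (a : ℕ → ℂ) (r : ℕ → ℝ → ℂ) (x : ℂ) (t : ℝ)
    {δ : ℝ} (hδ : 0 < δ) {Z W : ℕ → ℂ} (hZ : ∑ j ∈ Finset.range (n - 1), ‖Z j‖ ≤ δ)
    (hW : ∑ j ∈ Finset.range (n - 1), ‖W j‖ ≤ δ) :
    ‖riccatiRhsSeq n a r x t Z - riccatiRhsSeq n a r x t W‖ ≤
      riccatiLip n a r x (lipMax n δ) t * ∑ j ∈ Finset.range (n - 1), ‖Z j - W j‖ := by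
  set D := ∑ j ∈ Finset.range (n - 1), ‖Z j - W j‖ with hD
  have hsplit : riccatiRhsSeq n a r x t Z - riccatiRhsSeq n a r x t W =
      ∑ k ∈ Finset.Icc 1 (n - 1), (1 / (Nat.factorial k : ℂ)) *
        coeffPolyDeriv n (fun i => r i t) k x * (Z (k - 1) - W (k - 1)) +
      ∑ i ∈ Finset.Icc 2 n, ∑ j ∈ Finset.range (n - i + 1),
        (Nat.choose (i + j) j : ℂ) * (a (i + j) + r (i + j) t) * x ^ j *
          (bellNonlinear (i - 1) Z - bellNonlinear (i - 1) W) := by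
    simp only [riccatiRhsSeq, mul_sub, Finset.sum_sub_distrib]
    ring
  rw [hsplit, riccatiLip, add_mul]
  refine norm_add_le_of_le ?_ ?_
  · rw [Finset.sum_mul]
    refine norm_sum_le_of_le _ fun k hk => ?_
    rw [Finset.mem_Icc] at hk
    rw [norm_mul, norm_mul, norm_div, norm_one, Complex.norm_natCast]
    refine mul_le_mul_of_nonneg_left ?_ (by positivity)
    exact Finset.single_le_sum (f := fun j => ‖Z j - W j‖) (fun _ _ => norm_nonneg _)
      (Finset.mem_range.mpr (by omega))
  · have hsum := sum_Icc_sum_range_shift n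
      (fun i l => (Nat.choose i l : ℝ) * ‖x‖ ^ l * (‖a i‖ + ‖r i t‖))
    rw [← hsum, mul_assoc, mul_comm _ D, ← mul_assoc, mul_comm _ (Finset.sum _ _), Finset.sum_mul]
    refine norm_sum_le_of_le _ fun i hi => ?_
    rw [Finset.mem_Icc] at hi
    rw [Finset.sum_mul]
    refine norm_sum_le_of_le _ fun j _ => ?_
    rw [norm_mul]
    refine mul_le_mul ?_ (norm_bellNonlinear_sub_le_lipMax (by omega) hδ hZ hW) (norm_nonneg _)
      (by positivity)
    rw [norm_mul, norm_mul, Complex.norm_natCast, norm_pow, mul_right_comm]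
    exact mul_le_mul_of_nonneg_left (norm_add_le _ _) (by positivity)

/-! ### The contraction constant `L_0 + m Q_0` -/

section Contraction

variable {n : ℕ} {lam : Fin n → ℂ}

/-- Against the constants `‖a i‖` the kernel integrates exactly to `1 / |α|`; only the
time-dependent terms are replaced by suprema over `t`. -/
lemma integral_riccatiLip_le (a : ℕ → ℂ) {r : ℕ → ℝ → ℂ} (hr : ∀ i ≤ n, BddCont (r i)) (x : ℂ)
    {m : ℝ} (hm : 0 ≤ m) {α : ℝ} (hα : α ≠ 0) (t : ℝ) :
    ∫ s, ‖greenKernel (α : ℂ) t s‖ * riccatiLip n a r x m s ≤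
      ∑ l ∈ Finset.Icc 1 (n - 1), 1 / (Nat.factorial l : ℝ) *
        supNorm (absGreenOp (α : ℂ) (fun s => coeffPolyDeriv n (fun i => r i s) l x)) +
      m * ∑ i ∈ Finset.Icc 2 n, ∑ l ∈ Finset.range (i - 1), (Nat.choose i l : ℝ) * ‖x‖ ^ l *
        (‖a i‖ / |α| + supNorm (absGreenOp (α : ℂ) (fun s => ((‖r i s‖ : ℝ) : ℂ)))) := by
  have hK : Integrable fun s => ‖greenKernel (α : ℂ) t s‖ :=
    (integrable_greenKernel (ω := (α : ℂ)) (by simpa using hα) t).norm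
  have hrn : ∀ i ∈ Finset.Icc 2 n, BddCont (r i) := fun i hi => hr i (Finset.mem_Icc.mp hi).2
  have h1 : ∀ l, Integrable fun s =>
      ‖greenKernel (α : ℂ) t s‖ * ‖coeffPolyDeriv n (fun i => r i s) l x‖ := fun l =>
    integrable_norm_greenKernel_mul hα (BddCont.coeffPolyDeriv hr l x).norm t
  have h2 : ∀ i ∈ Finset.Icc 2 n, Integrable fun s => ‖greenKernel (α : ℂ) t s‖ * ‖a i‖ +
      ‖greenKernel (α : ℂ) t s‖ * ‖r i s‖ := fun i hi =>
    (hK.mul_const _).add (integrable_norm_greenKernel_mul hα (hrn i hi).norm t)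
  have hfun : (fun s => ‖greenKernel (α : ℂ) t s‖ * riccatiLip n a r x m s) = fun s =>
      ∑ l ∈ Finset.Icc 1 (n - 1), 1 / (Nat.factorial l : ℝ) *
        (‖greenKernel (α : ℂ) t s‖ * ‖coeffPolyDeriv n (fun i => r i s) l x‖) +
      m * ∑ i ∈ Finset.Icc 2 n, ∑ l ∈ Finset.range (i - 1), (Nat.choose i l : ℝ) * ‖x‖ ^ l *
        (‖greenKernel (α : ℂ) t s‖ * ‖a i‖ + ‖greenKernel (α : ℂ) t s‖ * ‖r i s‖) := by
    funext s
    rw [riccatiLip, mul_add, Finset.mul_sum, mul_left_comm]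
    congr 1
    · exact Finset.sum_congr rfl fun l _ => by ring
    · simp only [Finset.mul_sum]
      exact Finset.sum_congr rfl fun i _ => Finset.sum_congr rfl fun l _ => by ring
  have h3 : ∀ i ∈ Finset.Icc 2 n, Integrable fun s => ∑ l ∈ Finset.range (i - 1),
      (Nat.choose i l : ℝ) * ‖x‖ ^ l *
        (‖greenKernel (α : ℂ) t s‖ * ‖a i‖ + ‖greenKernel (α : ℂ) t s‖ * ‖r i s‖) := fun i hi =>
    integrable_finsetSum _ fun l _ => (h2 i hi).const_mul _
  rw [hfun, integral_add (integrable_finsetSum _ fun l _ => (h1 l).const_mul _)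
      ((integrable_finsetSum _ h3).const_mul _),
    integral_const_mul, integral_finsetSum _ (fun l _ => (h1 l).const_mul _),
    integral_finsetSum _ h3]
  refine add_le_add (Finset.sum_le_sum fun l _ => ?_)
    (mul_le_mul_of_nonneg_left (Finset.sum_le_sum fun i hi => ?_) hm)
  · rw [integral_const_mul, ← absGreenOp_eq α _ _ fun _ => rfl]
    exact mul_le_mul_of_nonneg_left
      (absGreenOp_le_supNorm hα (BddCont.coeffPolyDeriv hr l x) t) (by positivity)
  · rw [integral_finsetSum _ fun l _ => (h2 i hi).const_mul _]
    refine Finset.sum_le_sum fun l _ => ?_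
    rw [integral_const_mul, integral_add (hK.mul_const _)
      (integrable_norm_greenKernel_mul hα (hrn i hi).norm t), integral_mul_const,
      integral_norm_greenKernel (by simpa using hα), Complex.ofReal_re,
      ← absGreenOp_eq α (fun s => ((‖r i s‖ : ℝ) : ℂ)) _ fun s => by simp]
    refine mul_le_mul_of_nonneg_left (add_le_add (le_of_eq (by ring)) ?_) (by positivity)
    exact absGreenOp_le_supNorm hα ⟨Complex.continuous_ofReal.comp (hrn i hi).1.norm,
      by simpa using (hrn i hi).2⟩ t

lemma sum_integral_riccatiLip_le (hre : ∀ i j, i ≠ j → (lam i).re ≠ (lam j).re) (a : ℕ → ℂ)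
    {r : ℕ → ℝ → ℂ} (hr : ∀ i ≤ n, BddCont (r i)) (k : Fin n) {m : ℝ} (hm : 0 ≤ m) (t : ℝ) :
    ∑ j ∈ Finset.univ.erase k, alphaTilde lam k j / ‖gammaProd lam k j‖ *
        ∫ s, ‖greenKernel (alphaRe lam k j : ℂ) t s‖ * riccatiLip n a r (lam k) m s ≤
      constL r lam k + m * constQ a r lam k := by
  rw [constL, constQ, Finset.mul_sum, ← Finset.sum_add_distrib]
  refine Finset.sum_le_sum fun j hj => ?_
  have := alphaTilde_nonneg lam k j
  refine (mul_le_mul_of_nonneg_left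
    (integral_riccatiLip_le a hr (lam k) hm (alphaRe_ne_zero hre hj) t) (by positivity)).trans
    (le_of_eq ?_)
  rw [mul_add, Finset.mul_sum, mul_left_comm]
  congr 1
  · exact Finset.sum_congr rfl fun l _ => by rw [div_mul_eq_div_div]; ring
  · simp only [Finset.mul_sum]
    exact Finset.sum_congr rfl fun i _ => Finset.sum_congr rfl fun l _ => by ring

/-- Contraction estimate for `f ↦ (G^{λ_k}[f]^(i))_i` along functions that differ by at most a
multiple of the Lipschitz constant of the right hand side. -/
lemma sum_norm_greenRootDeriv_sub_le (hre : ∀ i j, i ≠ j → (lam i).re ≠ (lam j).re) (a : ℕ → ℂ)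
    {r : ℕ → ℝ → ℂ} (hr : ∀ i ≤ n, BddCont (r i)) (k : Fin n) {m : ℝ} (hm : 0 ≤ m)
    {f g : ℝ → ℂ} (hf : BddCont f) (hg : BddCont g) {D : ℝ} (hD : 0 ≤ D)
    (hfg : ∀ s, ‖f s - g s‖ ≤ riccatiLip n a r (lam k) m s * D) (t : ℝ) :
    ∑ i ∈ Finset.range (n - 1), ‖greenRootDeriv lam k i f t - greenRootDeriv lam k i g t‖ ≤
      (constL r lam k + m * constQ a r lam k) * D := by
  simp only [greenRootDeriv_sub hre k _ hf hg]
  refine (sum_norm_greenRootDeriv_le lam k _ t).trans ?_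
  refine le_trans ?_ (mul_le_mul_of_nonneg_right
    (sum_integral_riccatiLip_le hre a hr k hm t) hD)
  rw [Finset.sum_mul]
  refine Finset.sum_le_sum fun j hj => ?_
  have := alphaTilde_nonneg lam k j
  rw [mul_assoc]
  refine mul_le_mul_of_nonneg_left ?_ (by positivity)
  have hw := (bddCont_riccatiLip a hr (lam k) m).mul (BddCont.const D)
  obtain ⟨B, hB⟩ := hw.2
  refine (norm_greenOp_le_integral (alphaRe_ne_zero hre hj) hw.1 hB hfg t).trans (le_of_eq ?_)
  rw [← integral_mul_const]
  simp only [mul_assoc, alphaRe]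

lemma sum_norm_greenRootDeriv_pertTerm_le (hre : ∀ i j, i ≠ j → (lam i).re ≠ (lam j).re)
    (hn : 2 ≤ n) {r : ℕ → ℝ → ℂ} (hr : ∀ i ≤ n, BddCont (r i)) (k : Fin n) (t : ℝ) :
    ∑ i ∈ Finset.range (n - 1), ‖greenRootDeriv lam k i (pertTerm n r (lam k)) t‖ ≤
      constH r lam k := by
  have hP := BddCont.pertTerm hr (lam k)
  obtain ⟨B, hB⟩ := hP.2
  have hfun : (fun t : ℝ => ∑ i ∈ Finset.range (n - 1),
      ‖iteratedDeriv i (greenRoot lam k (pertTerm n r (lam k))) t‖) = fun t : ℝ =>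
      ∑ i ∈ Finset.range (n - 1), ‖greenRootDeriv lam k i (pertTerm n r (lam k)) t‖ := by
    funext t
    refine Finset.sum_congr rfl fun i hi => ?_
    rw [iteratedDeriv_greenRoot_of_lt hre hn k hP (Finset.mem_range.mp hi)]
  rw [constH, hfun, supNorm]
  refine le_trans (le_abs_self _) (le_ciSup (f := fun t : ℝ => ‖∑ i ∈ Finset.range (n - 1),
    ‖greenRootDeriv lam k i (pertTerm n r (lam k)) t‖‖) ?_ t)
  refine ⟨greenRootBound lam k * B, ?_⟩
  rintro _ ⟨t, rfl⟩
  simp only [Real.norm_eq_abs]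
  rw [abs_of_nonneg (Finset.sum_nonneg fun _ _ => norm_nonneg _)]
  exact sum_norm_greenRootDeriv_le_bound hre k hB t

lemma supNorm_nonneg {E : Type*} [NormedAddCommGroup E] (f : ℝ → E) : 0 ≤ supNorm f :=
  Real.iSup_nonneg fun _ => norm_nonneg _

lemma constL_nonneg (r : ℕ → ℝ → ℂ) (lam : Fin n → ℂ) (k : Fin n) : 0 ≤ constL r lam k :=
  Finset.sum_nonneg fun j _ => Finset.sum_nonneg fun _ _ => by
    have := alphaTilde_nonneg lam k j
    exact mul_nonneg (by positivity) (supNorm_nonneg _)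

lemma constQ_nonneg (a : ℕ → ℂ) (r : ℕ → ℝ → ℂ) (lam : Fin n → ℂ) (k : Fin n) :
    0 ≤ constQ a r lam k :=
  Finset.sum_nonneg fun j _ => Finset.sum_nonneg fun _ _ => Finset.sum_nonneg fun _ _ => by
    have := alphaTilde_nonneg lam k j
    exact mul_nonneg (by positivity) (add_nonneg (by positivity) (supNorm_nonneg _))

/-- Below the threshold `δ_{λ_k}` the contraction constant is less than one. -/
lemma IsDelta.contraction_lt_one {a : ℕ → ℂ} {r : ℕ → ℝ → ℂ} {k : Fin n} {d M : ℝ}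
    (hd : IsDelta a r lam k d) (hL : constL r lam k < 1) (hM : 0 < M) (hMd : M < d) :
    constL r lam k + lipMax n M * constQ a r lam k < 1 := by
  obtain ⟨hpos, hlt⟩ := hd.2.1 M hM hMd
  -- For `constQ = 0` the threshold is a division by zero; the claim is then `hL` itself.
  rcases (constQ_nonneg a r lam k).eq_or_lt with hQ | hQ
  · rw [← hQ]; linarith
  · rw [lt_div_iff₀ hQ] at hlt
    linarith

end Contraction

/-! ### The fixed point -/

section FixedPoint

variable {n : ℕ}

/-- The space of bounded continuous functions with values in `ℂ^{n-1}`, for the norm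
`sup_t ∑_i |z_i(t)|`. -/
abbrev JetSpace (n : ℕ) : Type :=
  BoundedContinuousFunction ℝ (PiLp 1 fun _ : Fin (n - 1) => ℂ)

/-- The value at `t` of an element of the jet space, extended by zero to a sequence. -/
def jetSeq (Z : JetSpace n) (t : ℝ) : ℕ → ℂ := extendZero fun i : Fin (n - 1) => Z t i

lemma sum_norm_extendZero (v : Fin (n - 1) → ℂ) :
    ∑ j ∈ Finset.range (n - 1), ‖extendZero v j‖ = ∑ i, ‖v i‖ := by
  rw [← Fin.sum_univ_eq_sum_range (fun j => ‖extendZero v j‖)]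
  simp [extendZero]

lemma sum_norm_jetSeq (Z : JetSpace n) (t : ℝ) :
    ∑ j ∈ Finset.range (n - 1), ‖jetSeq Z t j‖ = ‖Z t‖ := by
  rw [jetSeq, sum_norm_extendZero, PiLp.norm_eq_of_L1]

lemma jetSeq_sub (Z W : JetSpace n) (t : ℝ) (j : ℕ) :
    jetSeq Z t j - jetSeq W t j = jetSeq (Z - W) t j := by
  unfold jetSeq extendZero
  split_ifs <;> simp

lemma bddCont_jetSeq (Z : JetSpace n) (j : ℕ) : BddCont fun t => jetSeq Z t j := by
  by_cases hj : j < n - 1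
  · simp only [jetSeq, extendZero, hj, dite_true]
    refine ⟨by fun_prop, ‖Z‖, fun t => ?_⟩
    exact (PiLp.norm_apply_le (Z t) _).trans (Z.norm_coe_le_norm t)
  · simpa [jetSeq, extendZero, hj] using BddCont.const (0 : ℂ)

lemma exists_jetSpace_eq {F : ℕ → ℝ → ℂ} (hF : ∀ i < n - 1, Continuous (F i)) {B : ℝ}
    (hB : ∀ t, ∑ i ∈ Finset.range (n - 1), ‖F i t‖ ≤ B) :
    ∃ Z : JetSpace n, ∀ i < n - 1, ∀ t, jetSeq Z t i = F i t := by
  refine ⟨BoundedContinuousFunction.ofNormedAddCommGroup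
    (fun t => WithLp.toLp 1 fun i : Fin (n - 1) => F i t) ?_ B fun t => ?_, fun i hi t => ?_⟩
  · refine (PiLp.continuous_toLp 1 _).comp (continuous_pi fun i => hF i i.2)
  · rw [PiLp.norm_eq_of_L1, Fin.sum_univ_eq_sum_range (fun i => ‖F i t‖)]
    exact hB t
  · simp [jetSeq, extendZero, hi]

lemma norm_le_of_sum_norm_jetSeq_le {Z : JetSpace n} {C : ℝ} (hC : 0 ≤ C)
    (h : ∀ t, ∑ i ∈ Finset.range (n - 1), ‖jetSeq Z t i‖ ≤ C) : ‖Z‖ ≤ C :=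
  (BoundedContinuousFunction.norm_le hC).mpr fun t => by rw [← sum_norm_jetSeq]; exact h t

/-- Existence of a small solution of the integral equation `Z_i = -(G^{λ_k}[Φ_k[Z]])^(i)`. -/
lemma exists_jet_fixedPoint {lam : Fin n → ℂ} (hn : 2 ≤ n)
    (hre : ∀ i j, i ≠ j → (lam i).re ≠ (lam j).re) (a : ℕ → ℂ)
    {r : ℕ → ℝ → ℂ} (hr : ∀ i ≤ n, BddCont (r i)) (k : Fin n) {M : ℝ} (hM : 0 < M)
    (hcontr : constL r lam k + lipMax n M * constQ a r lam k < 1)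
    (hH : constH r lam k ≤ (1 - constL r lam k - lipMax n M * constQ a r lam k) * M) :
    ∃ Z : JetSpace n, ‖Z‖ ≤ M ∧ ∀ i < n - 1, ∀ t, jetSeq Z t i =
      -greenRootDeriv lam k i (fun s => riccatiRhsSeq n a r (lam k) s (jetSeq Z s)) t := by
  set κ := constL r lam k + lipMax n M * constQ a r lam k with hκ
  have hκ0 : 0 ≤ κ := add_nonneg (constL_nonneg r lam k)
    (mul_nonneg (lipMax_nonneg n M) (constQ_nonneg a r lam k))
  have hΦ : ∀ Z : JetSpace n,
      BddCont fun s => riccatiRhsSeq n a r (lam k) s (jetSeq Z s) := fun Z =>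
    BddCont.riccatiRhsSeq a hr (lam k) (bddCont_jetSeq Z)
  have hT : ∀ Z : JetSpace n, ∃ W : JetSpace n, ∀ i < n - 1, ∀ t, jetSeq W t i =
      -greenRootDeriv lam k i (fun s => riccatiRhsSeq n a r (lam k) s (jetSeq Z s)) t := by
    intro Z
    obtain ⟨B, hB⟩ := (hΦ Z).2
    refine exists_jetSpace_eq (F := fun i t =>
      -greenRootDeriv lam k i (fun s => riccatiRhsSeq n a r (lam k) s (jetSeq Z s)) t)
      (B := greenRootBound lam k * B) (fun i _ => (continuous_greenRootDeriv hre k i (hΦ Z)).neg) fun t => ?_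
    simp only [norm_neg]
    exact sum_norm_greenRootDeriv_le_bound hre k hB t
  choose T hT using hT
  have hbound : ∀ Z : JetSpace n, ‖Z‖ ≤ M → ∀ t,
      ∑ j ∈ Finset.range (n - 1), ‖jetSeq Z t j‖ ≤ M := fun Z hZ t =>
    (sum_norm_jetSeq Z t).trans_le ((Z.norm_coe_le_norm t).trans hZ)
  have hlip : ∀ Z W : JetSpace n, ‖Z‖ ≤ M → ‖W‖ ≤ M → ‖T Z - T W‖ ≤ κ * ‖Z - W‖ := by
    intro Z W hZ hW
    refine norm_le_of_sum_norm_jetSeq_le (by positivity) fun t => ?_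
    refine le_trans (le_of_eq ?_) (sum_norm_greenRootDeriv_sub_le hre a hr k (lipMax_nonneg n M)
      (hΦ Z) (hΦ W) (norm_nonneg (Z - W)) (fun s => ?_) t)
    · refine Finset.sum_congr rfl fun i hi => ?_
      rw [← jetSeq_sub, hT Z i (Finset.mem_range.mp hi), hT W i (Finset.mem_range.mp hi),
        ← norm_neg]
      congr 1; ring
    · refine (norm_riccatiRhsSeq_sub_le n a r (lam k) s hM (hbound Z hZ s)
        (hbound W hW s)).trans ?_
      simp only [jetSeq_sub, sum_norm_jetSeq]
      refine mul_le_mul_of_nonneg_left ((Z - W).norm_coe_le_norm s) ?_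
      exact add_nonneg (Finset.sum_nonneg fun _ _ => by positivity)
        (mul_nonneg (lipMax_nonneg n M)
          (Finset.sum_nonneg fun _ _ => Finset.sum_nonneg fun _ _ => by positivity))
  -- At the zero jet the linear and nonlinear parts vanish, so `T 0` is the negative jet of
  -- `G^{λ_k}[P(r; λ_k)]`, whose norm `constH` bounds.
  have hT0 : ‖T 0‖ ≤ (1 - κ) * M := by
    refine norm_le_of_sum_norm_jetSeq_le (by nlinarith) fun t => ?_
    refine le_trans (le_of_eq ?_) (((sum_norm_greenRootDeriv_pertTerm_le hre hn hr k t).trans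
      hH).trans (le_of_eq (by rw [hκ]; ring)))
    have h0 : ∀ s, riccatiRhsSeq n a r (lam k) s (jetSeq (0 : JetSpace n) s) =
        pertTerm n r (lam k) s := fun s => by
      have : jetSeq (0 : JetSpace n) s = fun _ => 0 := by
        funext j
        simp [jetSeq, extendZero]
      simp [this, riccatiRhsSeq, bellNonlinear_zero]
    refine Finset.sum_congr rfl fun i hi => ?_
    rw [hT 0 i (Finset.mem_range.mp hi), norm_neg]
    simp only [h0]
  -- The bounds `κ M` for `T Z - T 0` and `(1 - κ) M` for `T 0` add up to `M`.
  have hmaps : Set.MapsTo T (Metric.closedBall 0 M) (Metric.closedBall 0 M) := by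
    intro Z hZ
    rw [mem_closedBall_zero_iff] at hZ ⊢
    have h1 := hlip Z 0 hZ (by simpa using hM.le)
    rw [sub_zero] at h1
    have h2 : ‖T Z‖ ≤ ‖T Z - T 0‖ + ‖T 0‖ := by
      simpa using norm_add_le (T Z - T 0) (T 0)
    nlinarith [mul_le_mul_of_nonneg_left hZ hκ0]
  have hcw : ContractingWith ⟨κ, hκ0⟩
      (hmaps.restrict T (Metric.closedBall 0 M) (Metric.closedBall 0 M)) := by
    refine ⟨by exact_mod_cast hcontr, LipschitzWith.of_dist_le_mul fun Z W => ?_⟩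
    rw [Subtype.dist_eq, Subtype.dist_eq, dist_eq_norm, dist_eq_norm]
    exact hlip Z W (mem_closedBall_zero_iff.mp Z.2) (mem_closedBall_zero_iff.mp W.2)
  obtain ⟨Z, hZ, hfix, -⟩ := hcw.exists_fixedPoint' Metric.isClosed_closedBall.isComplete hmaps
    (x := 0) (by simpa using hM.le) (edist_ne_top _ _)
  refine ⟨Z, by simpa using hZ, fun i hi t => ?_⟩
  have := hT Z i hi t
  rwa [hfix.eq] at this

end FixedPoint

end PoincarePerron
end

noncomputable section

namespace PoincarePerron

open Filter Topology

/-! ### Bounds for the derivatives of `e^{xt + S(t)}` -/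

/-- The term `j = 0` is `x^i`. All other Bell polynomials share one bound, and the binomial weights
left over sum to `(‖x‖ + 1)^i - ‖x‖^i`. -/
lemma norm_bellShift_sub_le {n i : ℕ} (hi : i < n) {δ : ℝ} (hδ : 0 < δ) (x : ℂ) {Z : ℕ → ℂ}
    (hZ : ∑ j ∈ Finset.range (n - 1), ‖Z j‖ ≤ δ) :
    ‖bellShift i x Z - x ^ i‖ ≤ δ * (lipMax n δ + 1) * ((‖x‖ + 1) ^ i - ‖x‖ ^ i) := by
  have h1 : bellShift i x Z - x ^ i = ∑ j ∈ Finset.range i,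
      (Nat.choose i (j + 1) : ℂ) * x ^ (i - (j + 1)) * completeBell (j + 1) Z := by
    rw [bellShift, Finset.sum_range_succ']
    simp [completeBell]
  have h2 : (‖x‖ + 1) ^ i - ‖x‖ ^ i = ∑ j ∈ Finset.range i,
      (Nat.choose i (j + 1) : ℝ) * ‖x‖ ^ (i - (j + 1)) := by
    rw [add_comm, add_pow, Finset.sum_range_succ']
    simp [mul_comm]
  rw [h1, h2, Finset.mul_sum]
  refine norm_sum_le_of_le _ fun j hj => ?_
  rw [Finset.mem_range] at hj
  rw [norm_mul, norm_mul, Complex.norm_natCast, norm_pow, mul_comm]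
  exact mul_le_mul_of_nonneg_right
    (norm_completeBell_le_lipMax (by omega) (Nat.succ_ne_zero j) hδ hZ) (by positivity)

/-- Dependence of the right hand side of the Riccati type equation on the perturbation. -/
lemma exists_norm_riccatiRhsSeq_shift_le {n : ℕ} (hn : 2 ≤ n) {a : ℕ → ℂ} {r : ℕ → ℝ → ℂ} {x : ℂ}
    (hrn : r n = 0) (hx : (coeffPoly n a).IsRoot x) {δ : ℝ} (hδ : 0 < δ) :
    ∃ C, 0 ≤ C ∧ ∀ (s t ε : ℝ), (∀ i < n, ‖r i s - r i t‖ ≤ ε) → ∀ Z : ℕ → ℂ,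
      ∑ j ∈ Finset.range (n - 1), ‖Z j‖ ≤ δ →
      ‖riccatiRhsSeq n a r x s Z - riccatiRhsSeq n a r x t Z‖ ≤ C * ε := by
  have hm := lipMax_nonneg n δ
  have hpow : ∀ i : ℕ, 0 ≤ (‖x‖ + 1) ^ i - ‖x‖ ^ i := fun i =>
    sub_nonneg.mpr (pow_le_pow_left₀ (norm_nonneg x) (by linarith) i)
  have hC : ∀ i : ℕ, 0 ≤ ‖x‖ ^ i + δ * (lipMax n δ + 1) * ((‖x‖ + 1) ^ i - ‖x‖ ^ i) := fun i =>
    add_nonneg (by positivity) (mul_nonneg (by positivity) (hpow i))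
  refine ⟨∑ i ∈ Finset.range n,
    (‖x‖ ^ i + δ * (lipMax n δ + 1) * ((‖x‖ + 1) ^ i - ‖x‖ ^ i)),
    Finset.sum_nonneg fun i _ => hC i, fun s t ε hε Z hZ => ?_⟩
  -- For one and the same `Z` the part `D` and the coefficients `a_i` are independent of time, so
  -- only the increments of the `r_i` remain.
  have h1 : riccatiRhsSeq n a r x s Z - riccatiRhsSeq n a r x t Z =
      ∑ i ∈ Finset.range n, (r i s - r i t) * bellShift i x Z := by
    have hs := linConst_add_riccatiRhsSeq hn hrn hx s Z
    have ht := linConst_add_riccatiRhsSeq hn hrn hx t Z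
    rw [Finset.sum_range_succ, hrn] at hs ht
    have : ∑ i ∈ Finset.range n, (r i s - r i t) * bellShift i x Z =
        ∑ i ∈ Finset.range n, (a i + r i s) * bellShift i x Z -
          ∑ i ∈ Finset.range n, (a i + r i t) * bellShift i x Z := by
      rw [← Finset.sum_sub_distrib]
      exact Finset.sum_congr rfl fun i _ => by ring
    rw [this]
    simp only [Pi.zero_apply] at hs ht
    linear_combination hs - ht
  rw [h1, Finset.sum_mul]
  refine norm_sum_le_of_le _ fun i hi => ?_
  rw [Finset.mem_range] at hi
  rw [norm_mul, mul_comm]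
  refine mul_le_mul ?_ (hε i hi) (norm_nonneg _) (hC i)
  calc ‖bellShift i x Z‖ = ‖x ^ i + (bellShift i x Z - x ^ i)‖ := by rw [add_sub_cancel]
    _ ≤ _ := norm_add_le_of_le (norm_pow x i).le (norm_bellShift_sub_le hi hδ x hZ)

/-! ### Almost periodicity -/

/-- If `‖f (b m)‖ > m` for all `m`, the translates by `b` have no subsequence that converges even at
`0`. -/
lemma AlmostPeriodic.bddCont {f : ℝ → ℂ} (hf : AlmostPeriodic f) : BddCont f := by
  refine ⟨hf.1, ?_⟩
  by_contra! h
  choose b hb using fun m : ℕ => h m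
  obtain ⟨φ, hφ, g, hg⟩ := hf.2 b
  have h1 : Tendsto (fun m => ‖f (b (φ m))‖) atTop (𝓝 ‖g 0‖) := by
    simpa using (hg.tendsto_at 0).norm
  have h2 : Tendsto (fun m => ‖f (b (φ m))‖) atTop atTop :=
    tendsto_atTop_mono (fun m => (hb (φ m)).le)
      (tendsto_natCast_atTop_atTop.comp hφ.tendsto_atTop)
  exact not_tendsto_nhds_of_tendsto_atTop h2 _ h1

/-- Finitely many almost periodic functions have common convergent subsequences of translates. -/
lemma exists_common_subseq {r : ℕ → ℝ → ℂ} {n : ℕ} (hr : ∀ i < n, AlmostPeriodic (r i))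
    (b : ℕ → ℝ) : ∃ φ : ℕ → ℕ, StrictMono φ ∧ ∀ i < n, ∃ g : ℝ → ℂ,
      TendstoUniformly (fun (m : ℕ) (t : ℝ) => r i (t + b (φ m))) g atTop := by
  induction n with
  | zero => exact ⟨id, strictMono_id, fun i hi => absurd hi (Nat.not_lt_zero i)⟩
  | succ n ih =>
    obtain ⟨φ, hφ, h⟩ := ih fun i hi => hr i (by omega)
    obtain ⟨ψ, hψ, g, hg⟩ := (hr n (Nat.lt_succ_self n)).2 (b ∘ φ)
    refine ⟨φ ∘ ψ, hφ.comp hψ, fun i hi => ?_⟩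
    rcases Nat.lt_succ_iff_lt_or_eq.mp hi with hi | rfl
    · obtain ⟨g', hg'⟩ := h i hi
      exact ⟨g', fun u hu => hψ.tendsto_atTop.eventually (hg' u hu)⟩
    · exact ⟨g, hg⟩

/-! ### Translates of the fixed point -/

section Jet

variable {n : ℕ}

lemma norm_jetSeq_le (Z : JetSpace n) (t : ℝ) (i : ℕ) : ‖jetSeq Z t i‖ ≤ ‖Z‖ := by
  by_cases hi : i < n - 1
  · rw [jetSeq, extendZero, dif_pos hi]
    exact (PiLp.norm_apply_le (Z t) _).trans (Z.norm_coe_le_norm t)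
  · simp [jetSeq, extendZero, hi]

/-- Translation on the jet space. -/
def jetShift (Z : JetSpace n) (c : ℝ) : JetSpace n :=
  Z.compContinuous ⟨fun t => t + c, by fun_prop⟩

lemma jetSeq_jetShift (Z : JetSpace n) (c t : ℝ) : jetSeq (jetShift Z c) t = jetSeq Z (t + c) :=
  rfl

lemma dist_jetShift (Z : JetSpace n) (c d : ℝ) :
    dist (jetShift Z c) (jetShift Z d) ≤ ‖Z - jetShift Z (d - c)‖ := by
  rw [dist_eq_norm]
  refine (BoundedContinuousFunction.norm_le (norm_nonneg _)).mpr fun t => ?_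
  have := (Z - jetShift Z (d - c)).norm_coe_le_norm (t + c)
  simpa [jetShift] using this

/-- Along a common subsequence the translates of all `r_i` are Cauchy; by `h` so are those of `Z`,
and the jet space is complete. -/
lemma almostPeriodic_of_jetShift {r : ℕ → ℝ → ℂ} (hr : ∀ i < n, AlmostPeriodic (r i))
    {Z : JetSpace n} {C : ℝ} (hC : 0 ≤ C) (h : ∀ c ε : ℝ, 0 ≤ ε →
      (∀ i < n, ∀ t, ‖r i (t + c) - r i t‖ ≤ ε) → ‖Z - jetShift Z c‖ ≤ C * ε)
    (i : ℕ) : AlmostPeriodic fun t => jetSeq Z t i := by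
  refine ⟨(bddCont_jetSeq Z i).1, fun b => ?_⟩
  obtain ⟨φ, hφ, hconv⟩ := exists_common_subseq hr b
  choose! g hg using hconv
  refine ⟨φ, hφ, ?_⟩
  have hcauchy : CauchySeq fun m => jetShift Z (b (φ m)) := by
    rw [Metric.cauchySeq_iff']
    intro ε hε
    -- Gives `C * η < ε`, also when `C = 0`.
    set η := ε / (2 * (C + 1)) with hη
    have hη0 : 0 < η := by positivity
    have hev : ∀ᶠ m in atTop, ∀ i ∈ Finset.range n, ∀ t,
        dist (g i t) (r i (t + b (φ m))) < η / 2 :=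
      (Finset.range n).eventually_all.mpr fun i hi =>
        Metric.tendstoUniformly_iff.mp (hg i (Finset.mem_range.mp hi)) (η / 2) (by positivity)
    obtain ⟨N, hN⟩ := eventually_atTop.mp hev
    refine ⟨N, fun m hm => (dist_jetShift Z _ _).trans_lt ?_⟩
    refine (h _ η hη0.le fun i hi t => ?_).trans_lt ?_
    · have h1 := hN m hm i (Finset.mem_range.mpr hi) (t - b (φ m))
      have h2 := hN N le_rfl i (Finset.mem_range.mpr hi) (t - b (φ m))
      rw [sub_add_cancel] at h1
      rw [show t - b (φ m) + b (φ N) = t + (b (φ N) - b (φ m)) by ring] at h2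
      rw [← dist_eq_norm]
      refine (dist_triangle_left _ _ (g i (t - b (φ m)))).trans ?_
      linarith
    · rw [hη, ← mul_div_assoc, div_lt_iff₀ (by positivity)]
      nlinarith
  obtain ⟨W, hW⟩ := cauchySeq_tendsto_of_complete hcauchy
  refine ⟨fun t => jetSeq W t i, Metric.tendstoUniformly_iff.mpr fun ε hε => ?_⟩
  filter_upwards [Metric.tendsto_nhds.mp hW ε hε] with m hm t
  rw [dist_comm, dist_eq_norm] at hm
  rw [dist_eq_norm, ← jetSeq_jetShift, jetSeq_sub]
  exact (norm_jetSeq_le _ t i).trans_lt hm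

/-- The fixed point inherits almost periodicity from the perturbation. -/
lemma exists_norm_jetShift_le {lam : Fin n → ℂ} (hn : 2 ≤ n)
    (hre : ∀ i j, i ≠ j → (lam i).re ≠ (lam j).re) {a : ℕ → ℂ} {r : ℕ → ℝ → ℂ} (hrn : r n = 0)
    (hr : ∀ i ≤ n, BddCont (r i)) (k : Fin n) (hroot : (coeffPoly n a).IsRoot (lam k))
    {M : ℝ} (hM : 0 < M) (hcontr : constL r lam k + lipMax n M * constQ a r lam k < 1)
    {Z : JetSpace n} (hZM : ‖Z‖ ≤ M) (hfix : ∀ i < n - 1, ∀ t, jetSeq Z t i =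
      -greenRootDeriv lam k i (fun s => riccatiRhsSeq n a r (lam k) s (jetSeq Z s)) t) :
    ∃ C, 0 ≤ C ∧ ∀ c ε : ℝ, 0 ≤ ε →
      (∀ i < n, ∀ t, ‖r i (t + c) - r i t‖ ≤ ε) → ‖Z - jetShift Z c‖ ≤ C * ε := by
  set κ := constL r lam k + lipMax n M * constQ a r lam k with hκ
  have hκ0 : 0 ≤ κ := add_nonneg (constL_nonneg r lam k)
    (mul_nonneg (lipMax_nonneg n M) (constQ_nonneg a r lam k))
  obtain ⟨C, hC0, hC⟩ := exists_norm_riccatiRhsSeq_shift_le hn hrn hroot hM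
  have hG := greenRootBound_nonneg lam k
  have h1κ : 0 < 1 - κ := by linarith
  refine ⟨greenRootBound lam k * C / (1 - κ), by positivity, fun c ε hε0 hε => ?_⟩
  have hbound : ∀ t, ∑ j ∈ Finset.range (n - 1), ‖jetSeq Z t j‖ ≤ M := fun t =>
    (sum_norm_jetSeq Z t).trans_le ((Z.norm_coe_le_norm t).trans hZM)
  set f₁ := fun s => riccatiRhsSeq n a r (lam k) s (jetSeq Z s) with hf₁
  -- The intermediate term: shifted jet, unshifted perturbation. It separates the change of the jet
  -- from that of the `r_i`.
  set f₂ := fun s => riccatiRhsSeq n a r (lam k) s (jetSeq Z (s + c)) with hf₂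
  have b₁ : BddCont f₁ := BddCont.riccatiRhsSeq a hr (lam k) (bddCont_jetSeq Z)
  have b₂ : BddCont f₂ := BddCont.riccatiRhsSeq a hr (lam k) (bddCont_jetSeq (jetShift Z c))
  have b₃ : BddCont fun s => f₁ (s + c) := b₁.shift c
  -- The change of the jet costs the factor `κ < 1`, which is absorbed on the left; the change of
  -- the `r_i` costs `C * ε`.
  have key : ‖Z - jetShift Z c‖ ≤
      κ * ‖Z - jetShift Z c‖ + greenRootBound lam k * (C * ε) := by
    refine norm_le_of_sum_norm_jetSeq_le (by positivity) fun t => ?_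
    have h1 := sum_norm_greenRootDeriv_sub_le hre a hr k (lipMax_nonneg n M) b₁ b₂
      (norm_nonneg (Z - jetShift Z c)) (fun s => by
        refine (norm_riccatiRhsSeq_sub_le n a r (lam k) s hM (hbound s)
          (hbound (s + c))).trans ?_
        simp only [← jetSeq_jetShift, jetSeq_sub, sum_norm_jetSeq]
        refine mul_le_mul_of_nonneg_left ((Z - jetShift Z c).norm_coe_le_norm s) ?_
        exact add_nonneg (Finset.sum_nonneg fun _ _ => by positivity)
          (mul_nonneg (lipMax_nonneg n M)
            (Finset.sum_nonneg fun _ _ => Finset.sum_nonneg fun _ _ => by positivity))) t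
    have h2 := sum_norm_greenRootDeriv_le_bound hre k (f := fun s => f₁ (s + c) - f₂ s)
      (B := C * ε) (fun s => hC _ _ _ (fun i hi => hε i hi s) _ (hbound (s + c))) t
    refine le_trans ?_ (add_le_add h1 h2)
    rw [← Finset.sum_add_distrib]
    refine Finset.sum_le_sum fun i hi => ?_
    rw [Finset.mem_range] at hi
    rw [← jetSeq_sub, jetSeq_jetShift, hfix i hi, hfix i hi, ← greenRootDeriv_sub hre k i b₃ b₂,
      greenRootDeriv_shift, ← norm_neg]
    refine le_trans (le_of_eq ?_) (norm_sub_le _ _)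
    congr 1; ring
  rw [div_mul_eq_mul_div, le_div_iff₀ h1κ]
  linarith

end Jet

end PoincarePerron
end

noncomputable section

namespace PoincarePerron

open Filter Topology

/-! ### The solution attached to a root -/

section Riccati

variable {n : ℕ}

/-- Existence of a small almost periodic solution of the Riccati type equation. -/
lemma exists_almostPeriodic_riccatiSolution {lam : Fin n → ℂ} (hn : 2 ≤ n)
    {a : ℕ → ℂ} (ha : a n = 1) {r : ℕ → ℝ → ℂ} (hrn : r n = 0)
    (hr : ∀ i < n, AlmostPeriodic (r i)) (hroot : ∀ k, (coeffPoly n a).IsRoot (lam k))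
    (hre : ∀ i j, i ≠ j → (lam i).re ≠ (lam j).re) (k : Fin n) {M : ℝ} (hM : 0 < M)
    (hcontr : constL r lam k + lipMax n M * constQ a r lam k < 1)
    (hH : constH r lam k ≤ (1 - constL r lam k - lipMax n M * constQ a r lam k) * M) :
    ∃ z : ℝ → ℂ, IsRiccatiSolution n a r (lam k) z ∧
      (∀ t, z t = -greenRoot lam k (riccatiRhs n a r (lam k) z) t) ∧
      AlmostPeriodicUpTo (n - 2) z ∧ BddCont (riccatiRhs n a r (lam k) z) ∧
      ∀ t, ∑ i ∈ Finset.range (n - 1), ‖iteratedDeriv i z t‖ ≤ M := by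
  have hrb : ∀ i ≤ n, BddCont (r i) := by
    intro i hi
    rcases hi.eq_or_lt with rfl | hi
    · rw [hrn]
      exact BddCont.const 0
    · exact (hr i hi).bddCont
  obtain ⟨Z, hZM, hfix⟩ := exists_jet_fixedPoint hn hre a hrb k hM hcontr hH
  obtain ⟨C, hC, hshift⟩ := exists_norm_jetShift_le hn hre hrn hrb k (hroot k) hM hcontr hZM hfix
  set Φ := fun s => riccatiRhsSeq n a r (lam k) s (jetSeq Z s) with hΦ
  have hΦb : BddCont Φ := BddCont.riccatiRhsSeq a hrb (lam k) (bddCont_jetSeq Z)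
  set z : ℝ → ℂ := fun t => -greenRoot lam k Φ t with hz
  have hder : ∀ i < n - 1, iteratedDeriv i z = fun t => jetSeq Z t i := by
    intro i hi
    funext t
    rw [hz, iteratedDeriv_fun_neg, iteratedDeriv_greenRoot_of_lt hre hn k hΦb hi, hfix i hi]
  -- The right side reads only the entries below `n - 1`, which are by now the true derivatives of
  -- `z`.
  have hrhs : riccatiRhs n a r (lam k) z = Φ := by
    funext t
    rw [riccatiRhs_eq]
    exact riccatiRhsSeq_congr a r (lam k) t fun j hj => by rw [hder j hj]
  have hsmooth : ContDiff ℝ ((n - 1 : ℕ) : WithTop ℕ∞) z := (contDiff_greenRoot hre hn k hΦb).neg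
  refine ⟨z, ⟨hsmooth, fun t => ?_⟩, fun t => by rw [hrhs], ⟨hsmooth.of_le ?_, fun i hi => ?_⟩,
    hrhs ▸ hΦb, fun t => ?_⟩
  · have h1 : linConst n a (lam k) z t = -linConst n a (lam k) (greenRoot lam k Φ) t := by
      simp only [linConst, hz, iteratedDeriv_fun_neg, mul_neg, Finset.sum_neg_distrib]
    rw [hrhs, h1, linConst_greenRoot hre hn ha hroot k hΦb, neg_add_cancel]
  · exact_mod_cast (by omega : n - 2 ≤ n - 1)
  · rw [hder i (by omega)]
    exact almostPeriodic_of_jetShift hr hC hshift i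
  · have : ∑ i ∈ Finset.range (n - 1), ‖iteratedDeriv i z t‖ =
        ∑ i ∈ Finset.range (n - 1), ‖jetSeq Z t i‖ :=
      Finset.sum_congr rfl fun i hi => by rw [hder i (Finset.mem_range.mp hi)]
    rw [this, sum_norm_jetSeq]
    exact (Z.norm_coe_le_norm t).trans hZM

end Riccati

/-! ### Derivatives of exponentials -/

section Exponential

/-- Derivatives of an exponential in terms of complete Bell polynomials. -/
lemma iteratedDeriv_eq_completeBell_mul {u z : ℝ → ℂ} {m : ℕ}
    (hu : ∀ t, HasDerivAt u (z t * u t) t) (hz : ContDiff ℝ (m : WithTop ℕ∞) z)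
    (hum : ContDiff ℝ ((m + 1 : ℕ) : WithTop ℕ∞) u) {i : ℕ} (hi : i ≤ m + 1) (t : ℝ) :
    iteratedDeriv i u t = completeBell i (fun l => iteratedDeriv l z t) * u t := by
  induction i using Nat.strong_induction_on with
  | _ i ih =>
    rcases i with _ | i
    · simp [completeBell]
    · have hd : deriv u = z * u := funext fun t => (hu t).deriv
      -- The Leibniz rule for `z * u` is the recursion that defines the Bell polynomials.
      rw [iteratedDeriv_succ', hd, iteratedDeriv_mul
        (hz.contDiffAt.of_le (by exact_mod_cast (by omega : i ≤ m)))
        (hum.contDiffAt.of_le (by exact_mod_cast (by omega : i ≤ m + 1))),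
        completeBell, Finset.sum_mul, Fin.sum_univ_eq_sum_range (fun j => (Nat.choose i j : ℂ) *
          completeBell (i - j) (fun l => iteratedDeriv l z t) * iteratedDeriv j z t * u t)]
      refine Finset.sum_congr rfl fun j _ => ?_
      rw [ih (i - j) (by omega) (by omega)]
      ring

lemma contDiff_of_hasDerivAt_mul {u z : ℝ → ℂ} {m : ℕ}
    (hu : ∀ t, HasDerivAt u (z t * u t) t) (hz : ContDiff ℝ (m : WithTop ℕ∞) z) :
    ContDiff ℝ ((m + 1 : ℕ) : WithTop ℕ∞) u := by
  have hd : deriv u = fun t => z t * u t := funext fun t => (hu t).deriv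
  have hdiff : Differentiable ℝ u := fun t => (hu t).differentiableAt
  induction m with
  | zero =>
    rw [zero_add, Nat.cast_one, contDiff_one_iff_deriv, hd]
    exact ⟨hdiff, hz.continuous.mul hdiff.continuous⟩
  | succ m ih =>
    have := ih (hz.of_le (by exact_mod_cast Nat.le_succ m))
    rw [Nat.cast_succ, contDiff_succ_iff_deriv]
    refine ⟨hdiff, by simp, ?_⟩
    rw [hd]
    exact hz.mul this

lemma iteratedDeriv_cexp_mul (x : ℂ) (i : ℕ) (t : ℝ) :
    iteratedDeriv i (fun t : ℝ => Complex.exp (x * t)) t = x ^ i * Complex.exp (x * t) := by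
  induction i generalizing t with
  | zero => simp
  | succ i ih =>
    have h : HasDerivAt (fun t : ℝ => x ^ i * Complex.exp (x * t))
        (x ^ (i + 1) * Complex.exp (x * t)) t := by
      have := (((hasDerivAt_id (t : ℂ)).const_mul x).cexp.comp_ofReal).const_mul (x ^ i)
      refine this.congr_deriv ?_
      simp [pow_succ]; ring
    rw [iteratedDeriv_succ, funext ih]
    exact h.deriv

lemma iteratedDeriv_cexp_mul_mul {u z : ℝ → ℂ} {m : ℕ} (x : ℂ)
    (hu : ∀ t, HasDerivAt u (z t * u t) t) (hz : ContDiff ℝ (m : WithTop ℕ∞) z)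
    {i : ℕ} (hi : i ≤ m + 1) (t : ℝ) :
    iteratedDeriv i (fun t : ℝ => Complex.exp (x * t) * u t) t =
      bellShift i x (fun l => iteratedDeriv l z t) * (Complex.exp (x * t) * u t) := by
  have hum := contDiff_of_hasDerivAt_mul hu hz
  have he : ContDiff ℝ (i : WithTop ℕ∞) fun t : ℝ => Complex.exp (x * t) :=
    (contDiff_const.mul Complex.ofRealCLM.contDiff).cexp
  rw [mul_comm (bellShift _ _ _), iteratedDeriv_fun_mul he.contDiffAt
    (hum.contDiffAt.of_le (by exact_mod_cast hi)), bellShift, Finset.mul_sum,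
    ← Finset.sum_range_reflect]
  refine Finset.sum_congr rfl fun j hj => ?_
  have hj' : j ≤ i := by simpa [Nat.lt_succ_iff] using hj
  rw [show i + 1 - 1 - j = i - j by omega, Nat.choose_symm hj', Nat.sub_sub_self hj',
    iteratedDeriv_cexp_mul, iteratedDeriv_eq_completeBell_mul hu hz hum (hj'.trans hi)]
  ring

end Exponential

/-! ### The explicit solution solves the linear equation -/

section Solution

variable {n : ℕ} {lam : Fin n → ℂ}

/-- The explicit solution without the factor `e^{λ_k t}`. -/
def explicitFactor (lam : Fin n → ℂ) (k : Fin n) (f : ℝ → ℂ) (t : ℝ) : ℂ :=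
  Complex.exp (-∑ j ∈ Finset.univ.erase k,
    1 / (gammaProd lam k j * gammaRoot lam k j) * greenOp (gammaRoot lam k j) f t) *
  Complex.exp ((-1) ^ n * (∏ j ∈ Finset.univ.erase k, (lam j - lam k)⁻¹) *
    ∫ s in (0 : ℝ)..t, f s)

lemma explicitSolution_eq (a : ℕ → ℂ) (r : ℕ → ℝ → ℂ) (lam : Fin n → ℂ) (k : Fin n) (z : ℝ → ℂ)
    (t : ℝ) : explicitSolution a r lam k z t =
      Complex.exp (lam k * t) * explicitFactor lam k (riccatiRhs n a r (lam k) z) t := by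
  rw [explicitSolution, explicitFactor, mul_assoc]

lemma explicitFactor_ne_zero (lam : Fin n → ℂ) (k : Fin n) (f : ℝ → ℂ) (t : ℝ) :
    explicitFactor lam k f t ≠ 0 :=
  mul_ne_zero (Complex.exp_ne_zero _) (Complex.exp_ne_zero _)

/-- Differentiating the first exponent yields `-G^{λ_k}[f]` and a constant multiple of `f`; by
`sum_inv_gammaProd_mul_gammaRoot` the integral term cancels that multiple. So the factor is a
constant times `exp ∫ z` for `z = -G^{λ_k}[f]`. -/
lemma hasDerivAt_explicitFactor (hn : 2 ≤ n) (hre : ∀ i j, i ≠ j → (lam i).re ≠ (lam j).re)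
    (k : Fin n) {f : ℝ → ℂ} (hf : BddCont f) (t : ℝ) :
    HasDerivAt (explicitFactor lam k f) (-greenRoot lam k f t * explicitFactor lam k f t) t := by
  obtain ⟨B, hB⟩ := hf.2
  have hinj := injective_of_re hre
  have h1 := (HasDerivAt.fun_sum (u := Finset.univ.erase k) fun j hj =>
    (hasDerivAt_greenOp (alphaRe_ne_zero hre hj) hf.1 hB t).const_mul
      (1 / (gammaProd lam k j * gammaRoot lam k j))).fun_neg.cexp
  have h2 := ((hf.1.integral_hasStrictDerivAt 0 t).hasDerivAt.const_mul
    ((-1) ^ n * ∏ j ∈ Finset.univ.erase k, (lam j - lam k)⁻¹)).cexp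
  refine (h1.mul h2).congr_deriv ?_
  have h3 : ∑ j ∈ Finset.univ.erase k, 1 / (gammaProd lam k j * gammaRoot lam k j) *
      (f t + gammaRoot lam k j * greenOp (gammaRoot lam k j) f t) =
      ((-1) ^ n * ∏ j ∈ Finset.univ.erase k, (lam j - lam k)⁻¹) * f t + greenRoot lam k f t := by
    rw [← sum_inv_gammaProd_mul_gammaRoot hinj hn k, greenRoot, Finset.sum_mul,
      ← Finset.sum_add_distrib]
    refine Finset.sum_congr rfl fun j hj => ?_
    have := gammaRoot_ne_zero hinj (Finset.ne_of_mem_erase hj)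
    rw [mul_add, ← mul_assoc]
    congr 2
    rw [one_div, mul_inv, mul_assoc, inv_mul_cancel₀ this, mul_one, one_div]
  rw [h3, explicitFactor]
  ring

lemma iteratedDeriv_explicitSolution (hn : 2 ≤ n)
    (hre : ∀ i j, i ≠ j → (lam i).re ≠ (lam j).re) {a : ℕ → ℂ} {r : ℕ → ℝ → ℂ} (k : Fin n)
    {z : ℝ → ℂ} (hz : ContDiff ℝ ((n - 1 : ℕ) : WithTop ℕ∞) z)
    (hint : ∀ t, z t = -greenRoot lam k (riccatiRhs n a r (lam k) z) t)
    (hb : BddCont (riccatiRhs n a r (lam k) z)) {i : ℕ} (hi : i ≤ n) (t : ℝ) :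
    iteratedDeriv i (explicitSolution a r lam k z) t =
      bellShift i (lam k) (fun l => iteratedDeriv l z t) * explicitSolution a r lam k z t := by
  have hu : ∀ t, HasDerivAt (explicitFactor lam k (riccatiRhs n a r (lam k) z))
      (z t * explicitFactor lam k (riccatiRhs n a r (lam k) z) t) t := fun t => by
    rw [hint t]
    exact hasDerivAt_explicitFactor hn hre k hb t
  rw [funext (explicitSolution_eq a r lam k z)]
  exact iteratedDeriv_cexp_mul_mul (lam k) hu hz (by omega) t

lemma isLinearSolution_explicitSolution (hn : 2 ≤ n)
    (hre : ∀ i j, i ≠ j → (lam i).re ≠ (lam j).re) {a : ℕ → ℂ} (ha : a n = 1) {r : ℕ → ℝ → ℂ}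
    (hrn : r n = 0) (k : Fin n) (hroot : (coeffPoly n a).IsRoot (lam k))
    {z : ℝ → ℂ} (hz : IsRiccatiSolution n a r (lam k) z)
    (hint : ∀ t, z t = -greenRoot lam k (riccatiRhs n a r (lam k) z) t)
    (hb : BddCont (riccatiRhs n a r (lam k) z)) :
    IsLinearSolution n a r (explicitSolution a r lam k z) := by
  refine ⟨?_, fun t => ?_⟩
  · have hu : ∀ t, HasDerivAt (explicitFactor lam k (riccatiRhs n a r (lam k) z))
        (z t * explicitFactor lam k (riccatiRhs n a r (lam k) z) t) t := fun t => by
      rw [hint t]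
      exact hasDerivAt_explicitFactor hn hre k hb t
    have hum := contDiff_of_hasDerivAt_mul hu hz.1
    rw [Nat.sub_add_cancel (by omega : 1 ≤ n)] at hum
    rw [funext (explicitSolution_eq a r lam k z)]
    exact ((contDiff_const.mul Complex.ofRealCLM.contDiff).cexp).mul hum
  · have h1 := linConst_add_riccatiRhsSeq hn hrn hroot t (fun l => iteratedDeriv l z t)
    have h2 := hz.2 t
    rw [riccatiRhs_eq, linConst] at h2
    simp only [inv_factorial_mul_coeffPolyDeriv] at h2
    rw [h2, Finset.sum_range_succ, ha, hrn, Pi.zero_apply, add_zero, one_mul] at h1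
    have h3 : ∑ i ∈ Finset.range n, (a i + r i t) *
        iteratedDeriv i (explicitSolution a r lam k z) t =
        (∑ i ∈ Finset.range n, (a i + r i t) *
          bellShift i (lam k) (fun l => iteratedDeriv l z t)) *
          explicitSolution a r lam k z t := by
      rw [Finset.sum_mul]
      refine Finset.sum_congr rfl fun i hi => ?_
      rw [iteratedDeriv_explicitSolution hn hre k hz.1 hint hb (Finset.mem_range.mp hi).le,
        mul_assoc]
    rw [h3, iteratedDeriv_explicitSolution hn hre k hz.1 hint hb le_rfl, ← add_mul, add_comm,
      ← h1, zero_mul]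

end Solution

end PoincarePerron
end

noncomputable section

namespace PoincarePerron

/-! ### Linear independence -/

section Independence

variable {n : ℕ}

lemma sum_norm_mulVec_le {B : Matrix (Fin n) (Fin n) ℂ} {C : ℝ} (hC : ∀ k, ∑ i, ‖B i k‖ ≤ C)
    (v : Fin n → ℂ) : ∑ i, ‖B.mulVec v i‖ ≤ C * ∑ k, ‖v k‖ := by
  have h : ∀ i ∈ Finset.univ, ‖B.mulVec v i‖ ≤ ∑ k, ‖B i k‖ * ‖v k‖ := fun i _ =>
    norm_sum_le_of_le Finset.univ (f := fun k => B i k * v k) fun k _ => norm_mul_le _ _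
  refine (Finset.sum_le_sum h).trans ?_
  rw [Finset.sum_comm, Finset.mul_sum]
  refine Finset.sum_le_sum fun k _ => ?_
  rw [← Finset.sum_mul]
  exact mul_le_mul_of_nonneg_right (hC k) (norm_nonneg _)

lemma le_colNorm (B : Matrix (Fin n) (Fin n) ℂ) (k : Fin n) : ∑ i, ‖B i k‖ ≤ colNorm B :=
  le_ciSup (f := fun k => ∑ i, ‖B i k‖) (Set.finite_range _).bddAbove k

lemma colNorm_nonneg (B : Matrix (Fin n) (Fin n) ℂ) : 0 ≤ colNorm B :=
  Real.iSup_nonneg fun _ => Finset.sum_nonneg fun _ _ => norm_nonneg _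

/-- A perturbation of an invertible matrix that is small in the column norm is injective. -/
lemma eq_zero_of_mulVec_eq_zero {V W : Matrix (Fin n) (Fin n) ℂ} (hV : IsUnit V.det) {C : ℝ}
    (hC : ∀ k, ∑ i, ‖W i k - V i k‖ ≤ C) (hsmall : C * colNorm V⁻¹ < 1) {d : Fin n → ℂ}
    (hd : W.mulVec d = 0) : d = 0 := by
  -- On the kernel of `W` the map `-V⁻¹ (W - V)` is the identity, yet it shrinks the `ℓ¹` norm by
  -- the factor `C * colNorm V⁻¹ < 1`.
  have h1 : d = -V⁻¹.mulVec ((W - V).mulVec d) := by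
    rw [Matrix.sub_mulVec, hd, zero_sub, Matrix.mulVec_neg, neg_neg, Matrix.mulVec_mulVec,
      Matrix.nonsing_inv_mul V hV, Matrix.one_mulVec]
  have h2 : ∑ k, ‖d k‖ ≤ C * colNorm V⁻¹ * ∑ k, ‖d k‖ := by
    have h3 := sum_norm_mulVec_le (le_colNorm V⁻¹) ((W - V).mulVec d)
    have h4 := sum_norm_mulVec_le (B := W - V) hC d
    have h5 : ∑ k, ‖d k‖ = ∑ k, ‖V⁻¹.mulVec ((W - V).mulVec d) k‖ := by
      nth_rewrite 1 [h1]
      simp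
    rw [h5]
    refine h3.trans ?_
    rw [mul_comm C, mul_assoc, ← h5]
    exact mul_le_mul_of_nonneg_left h4 (colNorm_nonneg _)
  have h6 : ∑ k, ‖d k‖ = 0 := by
    have : 0 ≤ ∑ k, ‖d k‖ := Finset.sum_nonneg fun _ _ => norm_nonneg _
    nlinarith
  funext k
  exact norm_eq_zero.mp
    ((Finset.sum_eq_zero_iff_of_nonneg fun _ _ => norm_nonneg _).mp h6 k (Finset.mem_univ k))

lemma isUnit_det_vandermondeRows {lam : Fin n → ℂ} (h : Function.Injective lam) :
    IsUnit (vandermondeRows lam).det := by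
  rw [vandermondeRows, Matrix.det_transpose, isUnit_iff_ne_zero]
  exact Matrix.det_vandermonde_ne_zero_iff.mpr h

/-- Linear independence of functions whose Wronskian matrix at `0` is, up to scaling of the columns,
close to the Vandermonde matrix. -/
lemma linearIndependent_of_wronskian {lam : Fin n → ℂ} (hlam : Function.Injective lam)
    {y : Fin n → ℝ → ℂ} (hy : ∀ k, ContDiff ℝ (n : WithTop ℕ∞) (y k)) (hy0 : ∀ k, y k 0 ≠ 0)
    {W : Matrix (Fin n) (Fin n) ℂ} (hW : ∀ (i k : Fin n), iteratedDeriv i (y k) 0 = W i k * y k 0)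
    {C : ℝ} (hC : ∀ k, ∑ i : Fin n, ‖W i k - lam k ^ (i : ℕ)‖ ≤ C)
    (hsmall : C * colNorm (vandermondeRows lam)⁻¹ < 1) : LinearIndependent ℂ y := by
  rw [Fintype.linearIndependent_iff]
  intro c hc
  -- Differentiating a linear relation `i` times at `0` puts the vector of the `c k * y k 0` into
  -- the kernel of the scaled Wronskian matrix.
  have hd : W.mulVec (fun k => c k * y k 0) = 0 := by
    funext i
    have h1 : (fun t : ℝ => ∑ k, c k * y k t) = fun _ => 0 := by
      funext t
      simpa using congrFun hc t
    have h2 : iteratedDeriv (i : ℕ) (fun t : ℝ => ∑ k, c k * y k t) 0 =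
        iteratedDeriv (i : ℕ) (fun _ : ℝ => (0 : ℂ)) 0 := by rw [h1]
    have hyi : ∀ k, ContDiff ℝ ((i : ℕ) : WithTop ℕ∞) (y k) := fun k =>
      (hy k).of_le (by exact_mod_cast i.2.le)
    rw [iteratedDeriv_fun_sum fun k _ => (contDiff_const.mul (hyi k)).contDiffAt] at h2
    simp only [iteratedDeriv_const_mul_field, hW] at h2
    rw [Matrix.mulVec, dotProduct, Pi.zero_apply]
    refine Eq.trans (Finset.sum_congr rfl fun k _ => by ring) (h2.trans (by simp))
  have := eq_zero_of_mulVec_eq_zero (V := vandermondeRows lam)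
    (isUnit_det_vandermondeRows hlam) hC hsmall hd
  intro k
  exact (mul_eq_zero.mp (congrFun this k)).resolve_right (hy0 k)

lemma sum_norm_bellShift_sub_le (hn : 2 ≤ n) {δ : ℝ} (hδ : 0 < δ) (x : ℂ) {Z : ℕ → ℂ}
    (hZ : ∑ j ∈ Finset.range (n - 1), ‖Z j‖ ≤ δ) :
    ∑ i : Fin n, ‖bellShift i x Z - x ^ (i : ℕ)‖ ≤ δ * (lipMax n δ + 1) *
      ∑ i ∈ Finset.Icc 2 n, ((‖x‖ + 1) ^ (i - 1) - ‖x‖ ^ (i - 1)) := by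
  -- The exponent `i - 1 = 0` is missing on the left, but its term is `1 - 1 = 0`.
  have h1 : ∑ i ∈ Finset.Icc 2 n, ((‖x‖ + 1) ^ (i - 1) - ‖x‖ ^ (i - 1)) =
      ∑ i ∈ Finset.range n, ((‖x‖ + 1) ^ i - ‖x‖ ^ i) := by
    have := Finset.sum_Ico_add' (fun i => (‖x‖ + 1) ^ (i - 1) - ‖x‖ ^ (i - 1)) 1 n 1
    simp only [Nat.add_sub_cancel] at this
    rw [Finset.range_eq_Ico, Finset.sum_eq_sum_Ico_succ_bot (by omega), pow_zero, pow_zero,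
      sub_self, zero_add, this]
    rfl
  rw [h1, Fin.sum_univ_eq_sum_range (fun i => ‖bellShift i x Z - x ^ i‖), Finset.mul_sum]
  exact Finset.sum_le_sum fun i hi =>
    norm_bellShift_sub_le (Finset.mem_range.mp hi) hδ x hZ

end Independence

end PoincarePerron
end

open PoincarePerron
theorem theorem3p4 (n : ℕ) (hn : 2 ≤ n)
    -- coefficients `a_0, …, a_n` with `a_n = 1`, perturbations `r_0, …, r_n` with `r_n = 0`;
    -- entries with index above `n` play no role
    (a : ℕ → ℂ) (ha : a n = 1)
    (r : ℕ → ℝ → ℂ) (hrn : r n = 0) (hr : ∀ i < n, AlmostPeriodic (r i))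
    -- the roots of the characteristic polynomial, with pairwise different real parts
    (lam : Fin n → ℂ) (hroot : ∀ k, (coeffPoly n a).IsRoot (lam k))
    (hre : ∀ i j, i ≠ j → (lam i).re ≠ (lam j).re)
    (hL : ∀ k, constL r lam k < 1)
    (delta : Fin n → ℝ) (hdelta : ∀ k, IsDelta a r lam k (delta k))
    (M : Fin n → ℝ) (hMpos : ∀ k, 0 < M k) (hMlt : ∀ k j, M k < delta j)
    (hH : ∀ k, constH r lam k ≤ (1 - constL r lam k - lipMax n (M k) * constQ a r lam k) * M k)
    (hsmall :
      (⨆ k, M k * (lipMax n (M k) + 1) *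
        ∑ i ∈ Finset.Icc 2 n, ((‖lam k‖ + 1) ^ (i - 1) - ‖lam k‖ ^ (i - 1))) *
        colNorm (vandermondeRows lam)⁻¹ < 1) :
    ∃ y z : Fin n → ℝ → ℂ,
      IsFundamentalSystem n a r y ∧
      ∀ k,
        (∀ t, y k t = explicitSolution a r lam k (z k) t) ∧
        IsRiccatiSolution n a r (lam k) (z k) ∧
        (∀ t, z k t = -greenRoot lam k (riccatiRhs n a r (lam k) (z k)) t) ∧
        AlmostPeriodicUpTo (n - 2) (z k) := by
  have hz := fun k => exists_almostPeriodic_riccatiSolution hn ha hrn hr hroot hre k (hMpos k)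
    ((hdelta k).contraction_lt_one (hL k) (hMpos k) (hMlt k k)) (hH k)
  choose z hz hint hap hb hM using hz
  have hsol := fun k =>
    isLinearSolution_explicitSolution hn hre ha hrn k (hroot k) (hz k) (hint k) (hb k)
  refine ⟨fun k => explicitSolution a r lam k (z k), z, ⟨hsol, ?_⟩,
    fun k => ⟨fun _ => rfl, hz k, hint k, hap k⟩⟩
  refine linearIndependent_of_wronskian (injective_of_re hre) (fun k => (hsol k).1) (fun k => ?_)
    (W := fun i k => bellShift i (lam k) fun l => iteratedDeriv l (z k) 0) (fun i k => ?_)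
    (fun k => ?_) hsmall
  · rw [explicitSolution_eq]
    exact mul_ne_zero (Complex.exp_ne_zero _) (explicitFactor_ne_zero _ _ _ _)
  · exact iteratedDeriv_explicitSolution hn hre k (hz k).1 (hint k) (hb k) i.2.le 0
  · refine (sum_norm_bellShift_sub_le hn (hMpos k) (lam k) (hM k 0)).trans ?_
    exact le_ciSup (f := fun k => M k * (lipMax n (M k) + 1) *
      ∑ i ∈ Finset.Icc 2 n, ((‖lam k‖ + 1) ^ (i - 1) - ‖lam k‖ ^ (i - 1)))
      (Set.finite_range _).bddAbove k
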